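/- There is an absolute constant $C>0$ such that for all integers $N\ge 0$ and $B\ge 2$ and every search sequence $X=x_1,\dots,x_m$ over the key universe $\mathcal U=\{1,\dots,N\}$, $$\mathrm{OPT}_{\mathrm{BST}}(X)\;\le\; C\,\log B\cdot \mathrm{OPT}_{\text{B-tree}}(X),$$ where each $\mathrm{OPT}$ is the minimum, over all valid initial trees on $\mathcal U$ and all executions, of the total cost of executing $X$ in the model concerned. Moreover, with the same $C$, for every binary search tree $T_0$ on $\mathcal U$ the inequality $\mathrm{OPT}_{\mathrm{BST}}(T_0,X)\le C\log B\cdot \mathrm{OPT}_{\text{B-tree}}(T_0,X)$ holds for the optimal costs of executing $X$ when the initial tree in both models is $T_0$ (regarded in the B-tree model as a tree with one key per node). The models are as follows. In both, the searches are executed one after the other on the current tree. For each search a single pointer is placed at the root at unit cost, and then any sequence of unit-cost operations is performed, such that at some moment of the search for $x_i$ the pointer is at the node that stores $x_i$. The cost of executing $X$ is the total number of these unit costs. *BST model.* The tree is a binary search tree with exactly the keys of $\mathcal U$. The operations are: moving the pointer to the parent, the left child or the right child of the current node; and rotating the edge between the current node and its parent. *B-tree model with parameter $B$.* Every node $v$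 stores $n(v)$ keys, $1\le n(v)\le B-1$, and has $n(v)+1$ child pointers, some of which may be null; the keys of the tree are exactly those of $\mathcal U$ and satisfy the in-order condition (the $i$-th key of a node lies between the keys of its $i$-th and those of its $(i+1)$-st subtree). The operations are: * *Move*: the pointer moves to a child or to the parent of the current node. * *Rotation* of the edge between the current node $u$ and its parent $p$: let $P$ be the union of the keys of $u$ and $p$ in increasing order; the keys of $u$ form a nonempty interval of $P$. This interval is replaced by any nonempty interval of $P$, the other keys of $P$ being stored at $p$ and the subtrees being redistributed accordingly; afterwards both nodes must have at most $B-1$ keys. If $p$ has no key left, it is deleted and $u$ takes its place. * *Split* of the current node $u$, having at least three keys, at a key $k$ of $u$ that is neither its smallest nor its largest: $k$ is promoted to the parent of $u$, which must not be full (i.e. must have fewer than $B-1$ keys), and $u$ is replaced by two nodes that contain the smaller and the larger keys of $u$. If $u$ is the root, $k$ forms a new root instead. Afterwards the pointer is at one of the two halves. * *Join* of the current node with an adjacent sibling, where the two store at most $B-2$ keys in total: the unique key of the parent that separates them is demoted, and it is merged with the keys and children of the two nodes into one node, where the pointer is then. If the parent has no key left, it is deleted and the joined node takes its place. -/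

import Mathlib

/-!
Search trees accessed through a single pointer: the binary search tree (BST) model and the
(dynamic) B-tree model, with unit-cost operations, and the optimal offline cost of a sequence of
searches in each of them. Null pointers are the trees `nil`.
-/

universe u

/-! ### Executions in a pointer model -/

/-- A model in which searches are executed by one pointer into a tree: a state consists of a tree
and the position of the pointer in it, and `step` is the relation of the unit-cost operations. -/
structure PointerModel (α : Type u) where
  /-- the trees of the model -/
  Tree : Type u
  /-- a tree together with the position of the pointer -/
  State : Type u
  /-- the pointer is placed at the root of a tree -/
  start : Tree → State
  /-- forget the pointer -/
  tree : State → Tree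
  /-- one unit-cost operation -/
  step : State → State → Prop
  /-- the node that the pointer is at stores the given key -/
  Touches : State → α → Prop

namespace PointerModel

variable {α : Type u} (M : PointerModel α)

/-- `M.Steps n s s'`: some `n` unit-cost operations lead from `s` to `s'`. -/
inductive Steps : ℕ → M.State → M.State → Prop
  | refl (s : M.State) : Steps 0 s s
  | tail {n : ℕ} {s s' s'' : M.State} : Steps n s s' → M.step s' s'' → Steps (n + 1) s s''

/-- `M.Search t x c t'`: a search for `x` in the tree `t` can be executed at cost `c` so that the
tree `t'` results. The pointer is initialized at the root at unit cost, and the node that holds `x`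
is touched at some moment of the search, before or after which the tree may be restructured. -/
def Search (t : M.Tree) (x : α) (c : ℕ) (t' : M.Tree) : Prop :=
  ∃ (m n : ℕ) (s s' : M.State), M.Steps m (M.start t) s ∧ M.Touches s x ∧ M.Steps n s s' ∧
    M.tree s' = t' ∧ c = 1 + m + n

/-- `M.Serves t X c`: the search sequence `X` can be executed at total cost `c` when the initial
tree is `t`. -/
inductive Serves : M.Tree → List α → ℕ → Prop
  | nil (t : M.Tree) : Serves t [] 0
  | cons {t t' : M.Tree} {x : α} {X : List α} {c d : ℕ} :
      M.Search t x c t' → Serves t' X d → Serves t (x :: X) (c + d)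

/-- The optimal offline cost of `X` for the initial tree `t`; it is `⊤` if `X` cannot be
executed. -/
noncomputable def optFrom (t : M.Tree) (X : List α) : ℕ∞ :=
  ⨅ (c : ℕ) (_ : M.Serves t X c), (c : ℕ∞)

end PointerModel

/-- A list of keys is the complete list of all keys, in strictly increasing order. -/
def IsKeyOrder {α : Type u} [LT α] (l : List α) : Prop :=
  l.Pairwise (· < ·) ∧ ∀ x : α, x ∈ l

/-! ### The BST model -/

section BST

variable {α : Type u}

/-- The keys of a binary tree in symmetric order. -/
def BinaryTree.keysInorder : BinaryTree α → List α
  | .nil => []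
  | .node k l r => l.keysInorder ++ k :: r.keysInorder

/-- A binary search tree on all keys of `α`: each key is larger than all keys of its left subtree
and smaller than all keys of its right subtree, that is, the keys increase in symmetric order. -/
def BinaryTree.IsBST [LT α] (t : BinaryTree α) : Prop :=
  IsKeyOrder t.keysInorder

/-- A node from which the pointer has moved down to a child, without the subtree of that child. -/
inductive BSTFrame (α : Type u) : Type u
  /-- the pointer has moved to the left child: the key and the right subtree -/
  | left (k : α) (r : BinaryTree α)
  /-- the pointer has moved to the right child: the key and the left subtree -/
  | right (k : α) (l : BinaryTree α)

/-- Put back the subtree of the child. -/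
def BSTFrame.fill : BSTFrame α → BinaryTree α → BinaryTree α
  | .left k r, t => .node k t r
  | .right k l, t => .node k l t

/-- A binary tree with a pointer: the subtree rooted at the current node, and the ancestors of the
current node from its parent up to the root. -/
structure BSTState (α : Type u) : Type u where
  /-- the subtree of the current node -/
  focus : BinaryTree α
  /-- the rest of the tree, the parent of the current node first -/
  above : List (BSTFrame α)

/-- The whole tree. -/
def BSTState.tree (s : BSTState α) : BinaryTree α :=
  s.above.foldl (fun t f => f.fill t) s.focus

/-- The key of the current node is `x`. -/
def BSTState.Touches (s : BSTState α) (x : α) : Prop :=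
  ∃ l r, s.focus = .node x l r

/-- The unit-cost operations of the BST model: the pointer moves to the left child, to the right
child or to the parent of the current node, or the edge between the current node and its parent is
rotated (and the pointer stays at its node). -/
inductive BSTStep : BSTState α → BSTState α → Prop
  | moveLeft (k k' : α) (l r r' : BinaryTree α) (F : List (BSTFrame α)) :
      BSTStep ⟨.node k (.node k' l r) r', F⟩ ⟨.node k' l r, .left k r' :: F⟩
  | moveRight (k k' : α) (l' l r : BinaryTree α) (F : List (BSTFrame α)) :
      BSTStep ⟨.node k l' (.node k' l r), F⟩ ⟨.node k' l r, .right k l' :: F⟩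
  | moveUp (t : BinaryTree α) (f : BSTFrame α) (F : List (BSTFrame α)) :
      BSTStep ⟨t, f :: F⟩ ⟨f.fill t, F⟩
  | rotateLeftChild (k p : α) (a b c : BinaryTree α) (F : List (BSTFrame α)) :
      BSTStep ⟨.node k a b, .left p c :: F⟩ ⟨.node k a (.node p b c), F⟩
  | rotateRightChild (k p : α) (a b c : BinaryTree α) (F : List (BSTFrame α)) :
      BSTStep ⟨.node k b c, .right p a :: F⟩ ⟨.node k (.node p a b) c, F⟩

/-- The BST model. -/
def bstModel (α : Type u) : PointerModel α where
  Tree := BinaryTree α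
  State := BSTState α
  start t := ⟨t, []⟩
  tree := BSTState.tree
  step := BSTStep
  Touches := BSTState.Touches

/-- The optimal offline cost of `X` in the BST model, over all initial trees and all executions. -/
noncomputable def bstOpt [LT α] (X : List α) : ℕ∞ :=
  ⨅ (t : BinaryTree α) (_ : t.IsBST), (bstModel α).optFrom t X

end BST

/-! ### The B-tree model -/

/-- Multiway trees: a node has a list of keys and a list of children (`nil` is a null child). -/
inductive BTree (α : Type u) : Type u
  | nil : BTree α
  | node (keys : List α) (children : List (BTree α)) : BTree α

section BTree

variable {α : Type u}

mutual
/-- The keys of a multiway tree in symmetric order: `c₁, x₁, c₂, x₂, …, xₙ, cₙ₊₁`. -/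
def BTree.keysInorder : BTree α → List α
  | .nil => []
  | .node ks cs => BTree.keysInorderAux ks cs

/-- Interleave a list of keys with the keys of a list of trees. -/
def BTree.keysInorderAux : List α → List (BTree α) → List α
  | ks, [] => ks
  | [], c :: cs => c.keysInorder ++ BTree.keysInorderAux [] cs
  | k :: ks, c :: cs => c.keysInorder ++ k :: BTree.keysInorderAux ks cs
end

/-- The shape condition for parameter `B`: each node has at least one and at most `B - 1` keys, and
one child pointer (which may be null) more than it has keys. -/
inductive BTree.WellFormed (B : ℕ) : BTree α → Prop
  | nil : WellFormed B .nil
  | node (ks : List α) (cs : List (BTree α)) : ks ≠ [] → ks.length + 1 ≤ B →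
      cs.length = ks.length + 1 → (∀ c ∈ cs, WellFormed B c) → WellFormed B (.node ks cs)

/-- A valid B-tree on all keys of `α`: the shape is right and the keys are in symmetric order. -/
def BTree.IsBTree [LT α] (B : ℕ) (t : BTree α) : Prop :=
  t.WellFormed B ∧ IsKeyOrder t.keysInorder

/-- A node from which the pointer has moved down to a child, without the subtree of that child: the
keys and the children to the left and to the right of that child, in symmetric order. -/
structure BTreeFrame (α : Type u) : Type u where
  /-- the keys to the left -/
  lkeys : List α
  /-- the children to the left -/
  lchildren : List (BTree α)
  /-- the keys to the right -/
  rkeys : List α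
  /-- the children to the right -/
  rchildren : List (BTree α)

/-- Put back the subtree of the child. -/
def BTreeFrame.fill (f : BTreeFrame α) (t : BTree α) : BTree α :=
  .node (f.lkeys ++ f.rkeys) (f.lchildren ++ t :: f.rchildren)

/-- Put the parent `f` of the current node on top of the list `F` of its ancestors. If the parent
has run out of keys (so that the current node is its only child), it is deleted instead, and the
current node becomes a child of the parent's parent, or the root if there is none. -/
def BTreeFrame.push (f : BTreeFrame α) (F : List (BTreeFrame α)) : List (BTreeFrame α) :=
  if (f.lkeys ++ f.rkeys).isEmpty then F else f :: F

/-- A multiway tree with a pointer: the subtree rooted at the current node, and the ancestors of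
the current node from its parent up to the root. -/
structure BTreeState (α : Type u) : Type u where
  /-- the subtree of the current node -/
  focus : BTree α
  /-- the rest of the tree, the parent of the current node first -/
  above : List (BTreeFrame α)

/-- The whole tree. -/
def BTreeState.tree (s : BTreeState α) : BTree α :=
  s.above.foldl (fun t f => f.fill t) s.focus

/-- The current node stores the key `x`. -/
def BTreeState.Touches (s : BTreeState α) (x : α) : Prop :=
  ∃ ks cs, s.focus = .node ks cs ∧ x ∈ ks

/-- The unit-cost operations of the B-tree model with parameter `B`. -/
inductive BTreeStep (B : ℕ) : BTreeState α → BTreeState α → Prop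
  /-- The pointer moves to a child. -/
  | moveDown (L R ks : List α) (CL CR cs : List (BTree α)) (F : List (BTreeFrame α)) :
      CL.length = L.length →
      BTreeStep B ⟨.node (L ++ R) (CL ++ .node ks cs :: CR), F⟩ ⟨.node ks cs, ⟨L, CL, R, CR⟩ :: F⟩
  /-- The pointer moves to the parent. -/
  | moveUp (t : BTree α) (f : BTreeFrame α) (F : List (BTreeFrame α)) :
      BTreeStep B ⟨t, f :: F⟩ ⟨f.fill t, F⟩
  /-- Rotation of the edge between the current node `u` and its parent: in the sequence of all keys
  and children of the two nodes, in symmetric order, the nonempty interval of keys that is stored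
  at `u` is replaced by another one, and the rest is stored at the parent; both nodes have at most
  `B - 1` keys afterwards. A parent without keys is deleted. -/
  | rotate (L U R L' U' R' : List α) (CL CU CR CL' CU' CR' : List (BTree α))
      (F : List (BTreeFrame α)) :
      L' ++ U' ++ R' = L ++ U ++ R → CL' ++ CU' ++ CR' = CL ++ CU ++ CR →
      CL'.length = L'.length → CU'.length = U'.length + 1 → CR'.length = R'.length →
      U' ≠ [] → U'.length + 1 ≤ B → (L' ++ R').length + 1 ≤ B →
      BTreeStep B ⟨.node U CU, ⟨L, CL, R, CR⟩ :: F⟩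
        ⟨.node U' CU', BTreeFrame.push ⟨L', CL', R', CR'⟩ F⟩
  /-- The current node, which is not the root and whose parent is not full, is split at its key `k`
  (neither the smallest nor the largest one); the pointer is at the left half afterwards. -/
  | splitL (L R U V : List α) (k : α) (CL CR CU CV : List (BTree α)) (F : List (BTreeFrame α)) :
      U ≠ [] → V ≠ [] → CU.length = U.length + 1 → CV.length = V.length + 1 →
      (L ++ R).length + 2 ≤ B →
      BTreeStep B ⟨.node (U ++ k :: V) (CU ++ CV), ⟨L, CL, R, CR⟩ :: F⟩
        ⟨.node U CU, ⟨L, CL, k :: R, .node V CV :: CR⟩ :: F⟩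
  /-- The same, with the pointer at the right half afterwards. -/
  | splitR (L R U V : List α) (k : α) (CL CR CU CV : List (BTree α)) (F : List (BTreeFrame α)) :
      U ≠ [] → V ≠ [] → CU.length = U.length + 1 → CV.length = V.length + 1 →
      (L ++ R).length + 2 ≤ B →
      BTreeStep B ⟨.node (U ++ k :: V) (CU ++ CV), ⟨L, CL, R, CR⟩ :: F⟩
        ⟨.node V CV, ⟨L ++ [k], CL ++ [.node U CU], R, CR⟩ :: F⟩
  /-- The current node, which is the root, is split: the promoted key forms the new root. -/
  | splitRootL (U V : List α) (k : α) (CU CV : List (BTree α)) :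
      U ≠ [] → V ≠ [] → CU.length = U.length + 1 → CV.length = V.length + 1 →
      BTreeStep B ⟨.node (U ++ k :: V) (CU ++ CV), []⟩
        ⟨.node U CU, [⟨[], [], [k], [.node V CV]⟩]⟩
  /-- The same, with the pointer at the right half afterwards. -/
  | splitRootR (U V : List α) (k : α) (CU CV : List (BTree α)) :
      U ≠ [] → V ≠ [] → CU.length = U.length + 1 → CV.length = V.length + 1 →
      BTreeStep B ⟨.node (U ++ k :: V) (CU ++ CV), []⟩
        ⟨.node V CV, [⟨[k], [.node U CU], [], []⟩]⟩
  /-- The current node is joined with the sibling to its right; the key `k` of the parent that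
  separates them is demoted, and the parent is deleted if this was its only key. -/
  | joinRight (L R U V : List α) (k : α) (CL CR CU CV : List (BTree α)) (F : List (BTreeFrame α)) :
      U.length + V.length + 2 ≤ B →
      BTreeStep B ⟨.node U CU, ⟨L, CL, k :: R, .node V CV :: CR⟩ :: F⟩
        ⟨.node (U ++ k :: V) (CU ++ CV), BTreeFrame.push ⟨L, CL, R, CR⟩ F⟩
  /-- The current node is joined with the sibling to its left. -/
  | joinLeft (L R U V : List α) (k : α) (CL CR CU CV : List (BTree α)) (F : List (BTreeFrame α)) :
      U.length + V.length + 2 ≤ B →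
      BTreeStep B ⟨.node V CV, ⟨L ++ [k], CL ++ [.node U CU], R, CR⟩ :: F⟩
        ⟨.node (U ++ k :: V) (CU ++ CV), BTreeFrame.push ⟨L, CL, R, CR⟩ F⟩

/-- The B-tree model with parameter `B`. -/
def btreeModel (α : Type u) (B : ℕ) : PointerModel α where
  Tree := BTree α
  State := BTreeState α
  start t := ⟨t, []⟩
  tree := BTreeState.tree
  step := BTreeStep B
  Touches := BTreeState.Touches

/-- The optimal offline cost of `X` in the B-tree model, over all initial trees and all
executions. -/
noncomputable def btreeOpt [LT α] (B : ℕ) (X : List α) : ℕ∞ :=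
  ⨅ (t : BTree α) (_ : t.IsBTree B), (btreeModel α B).optFrom t X

/-- A binary tree as a multiway tree with one key in each node. -/
def BinaryTree.toBTree : BinaryTree α → BTree α
  | .nil => .nil
  | .node k l r => .node [k] [l.toBTree, r.toBTree]

end BTree

/-! ### The potential of a shape -/

-- Each B-tree node is kept in the binary tree as a connected region with the same keys. Between
-- simulated operations the binary pointer rests at the root of the region of the current B-tree
-- node. Every region is treated as a splay tree of its own: its potential is the sum of `lg` of the
-- subtree sizes, where only keys of the region count. By the access lemma (`exists_splay`,
-- `exists_access`), bringing a key to the root of its region has amortized cost O(log B), since a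
-- region has fewer than B keys, and fewer than 2B in the middle of an operation.
--
-- The inequality has no additive term, so the simulation must start at potential zero. For this
-- reason the least potential `minPot n` of a shape with n nodes is subtracted from the potential of
-- each region with n keys. The excess is nonnegative; it vanishes for regions of optimal shape,
-- which serve when the initial tree is free, and for regions with a single key, which serve when it
-- is prescribed. The price is a change of `minPot` whenever regions are divided or merged. As
-- `minPot` is additive up to one logarithm (`minPot_add_le`, `minPot_add_minPot_le_add`), this
-- price is again O(log B).
--
-- All B-tree operations are composed of four: moving up, moving down, merging the current node into
-- its parent, and carving an interval of keys out of a node as a new child. Moving up is a splay in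
-- the parent's region. The other three use `exists_expose`: after accesses to the keys just before
-- and just after an interval, that interval fills a subtree at depth at most two in its region,
-- where it can be entered, cut off or absorbed while only O(1) logarithms change.

/-- The potential of a node with `n` keys of its own region in its subtree. -/
noncomputable def lg (n : ℕ) : ℝ := 5 * Real.log n

lemma lg_one : lg 1 = 0 := by simp [lg]

lemma lg_mono {m n : ℕ} (h : m ≤ n) : lg m ≤ lg n := by
  unfold lg
  rcases Nat.eq_zero_or_pos m with rfl | hm
  · simpa using Real.log_natCast_nonneg n
  · have := Real.log_le_log (by exact_mod_cast hm) (Nat.cast_le (α := ℝ).2 h)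
    linarith

lemma lg_nonneg (n : ℕ) : 0 ≤ lg n :=
  mul_nonneg (by norm_num) (Real.log_natCast_nonneg n)

/-- The gain from concavity that pays for two splaying levels. -/
lemma lg_add_lg_le {a b c : ℕ} (ha : 0 < a) (hb : 0 < b) (h : a + b ≤ c) :
    lg a + lg b + 6 ≤ 2 * lg c := by
  have ha' : (0 : ℝ) < a := by exact_mod_cast ha
  have hb' : (0 : ℝ) < b := by exact_mod_cast hb
  have h' : (a : ℝ) + b ≤ c := by exact_mod_cast h
  have h4 : Real.log (4 * (a * b)) ≤ Real.log ((c : ℝ) ^ 2) := by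
    apply Real.log_le_log (by positivity)
    nlinarith [sq_nonneg ((a : ℝ) - b)]
  rw [Real.log_mul (by norm_num) (by positivity), Real.log_mul ha'.ne' hb'.ne',
    Real.log_pow, show (4 : ℝ) = 2 ^ 2 by norm_num, Real.log_pow] at h4
  -- The gain is `10 * log 2 > 6.9`; the factor 5 in `lg` is chosen so that this exceeds 6.
  have := Real.log_two_gt_d9
  unfold lg
  push_cast at h4
  linarith

namespace BinaryTree

/-- The sum of the logarithmic sizes of all subtrees. -/
noncomputable def potential {α : Type u} : BinaryTree α → ℝ
  | nil => 0
  | node _ l r => l.potential + r.potential + lg (l.numNodes + r.numNodes + 1)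

lemma exists_numNodes_eq (n : ℕ) : ∃ s : BinaryTree Unit, s.numNodes = n := by
  induction n with
  | zero => exact ⟨nil, rfl⟩
  | succ n ih =>
    obtain ⟨s, hs⟩ := ih
    exact ⟨node () s nil, by simp [numNodes, hs]⟩

/-- A shape can be split at any position without increasing the potential. -/
lemma exists_split (s : BinaryTree Unit) :
    ∀ a b : ℕ, s.numNodes = a + b + 1 → ∃ s₁ s₂ : BinaryTree Unit, s₁.numNodes = a ∧
      s₂.numNodes = b ∧ s₁.potential + s₂.potential ≤ s.potential := by
  induction s with
  | nil => intro a b h; simp [numNodes] at h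
  | node k l r ihl ihr =>
    intro a b h
    simp only [numNodes] at h
    rcases lt_trichotomy a l.numNodes with hl | hl | hl
    · obtain ⟨s₁, s₂, h₁, h₂, h₃⟩ := ihl a (l.numNodes - a - 1) (by omega)
      refine ⟨s₁, node () s₂ r, h₁, by simp only [numNodes]; omega, ?_⟩
      have := lg_mono (show s₂.numNodes + r.numNodes + 1 ≤ l.numNodes + r.numNodes + 1 by omega)
      simp only [potential]
      linarith
    · refine ⟨l, r, hl.symm, by omega, ?_⟩
      have := lg_nonneg (l.numNodes + r.numNodes + 1)
      simp only [potential]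
      linarith
    · obtain ⟨s₁, s₂, h₁, h₂, h₃⟩ := ihr (a - l.numNodes - 1) b (by omega)
      refine ⟨node () l s₁, s₂, by simp only [numNodes]; omega, h₂, ?_⟩
      have := lg_mono (show l.numNodes + s₁.numNodes + 1 ≤ l.numNodes + r.numNodes + 1 by omega)
      simp only [potential]
      linarith

end BinaryTree

-- The minimum potential and its near-additivity.

open BinaryTree in
/-- The least potential of a shape with `n` nodes. -/
noncomputable def minPot (n : ℕ) : ℝ :=
  (treesOfNumNodesEq n).inf'
    ((exists_numNodes_eq n).imp fun _ h => mem_treesOfNumNodesEq.2 h) BinaryTree.potential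

lemma minPot_le (s : BinaryTree Unit) : minPot s.numNodes ≤ s.potential :=
  Finset.inf'_le _ (BinaryTree.mem_treesOfNumNodesEq.2 rfl)

lemma exists_potential_eq_minPot (n : ℕ) :
    ∃ s : BinaryTree Unit, s.numNodes = n ∧ s.potential = minPot n := by
  obtain ⟨s, hs, h⟩ := Finset.exists_mem_eq_inf' (s := BinaryTree.treesOfNumNodesEq n)
    ((BinaryTree.exists_numNodes_eq n).imp fun _ h => BinaryTree.mem_treesOfNumNodesEq.2 h)
    BinaryTree.potential
  exact ⟨s, BinaryTree.mem_treesOfNumNodesEq.1 hs, h.symm⟩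

lemma minPot_zero : minPot 0 = 0 := by
  obtain ⟨s, hs, h⟩ := exists_potential_eq_minPot 0
  cases s with
  | nil => simpa [BinaryTree.potential] using h.symm
  | node => simp [BinaryTree.numNodes] at hs

lemma minPot_add_add_one_le (a b : ℕ) :
    minPot (a + b + 1) ≤ minPot a + minPot b + lg (a + b + 1) := by
  obtain ⟨s, rfl, h⟩ := exists_potential_eq_minPot a
  obtain ⟨s', rfl, h'⟩ := exists_potential_eq_minPot b
  rw [← h, ← h']
  exact minPot_le (.node () s s')

lemma minPot_add_minPot_le (a b : ℕ) : minPot a + minPot b ≤ minPot (a + b + 1) := by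
  obtain ⟨s, hs, h⟩ := exists_potential_eq_minPot (a + b + 1)
  obtain ⟨s₁, s₂, rfl, rfl, h₃⟩ := s.exists_split a b hs
  linarith [minPot_le s₁, minPot_le s₂]

lemma minPot_one : minPot 1 = 0 := by
  have h₁ := minPot_add_add_one_le 0 0
  have h₂ := minPot_add_minPot_le 0 0
  simp only [minPot_zero, lg_one, zero_add] at h₁ h₂
  linarith

/-- Two shapes are put below an extra root, which is then deleted: `minPot` is monotone by the case
`b = 0` of `minPot_add_minPot_le`. This pays for carving one region into two. -/
lemma minPot_add_le (a b : ℕ) : minPot (a + b) ≤ minPot a + minPot b + lg (a + b + 1) := by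
  have h₁ := minPot_add_minPot_le (a + b) 0
  have h₂ := minPot_add_add_one_le a b
  rw [minPot_zero] at h₁
  simp only [add_zero] at h₁
  linarith

/-- An extra node is added above an optimal shape, and the result is split at the desired position.
This pays for merging two regions. -/
lemma minPot_add_minPot_le_add (a b : ℕ) :
    minPot a + minPot b ≤ minPot (a + b) + lg (a + b + 1) := by
  have h₁ := minPot_add_minPot_le a b
  have h₂ := minPot_add_add_one_le (a + b) 0
  rw [minPot_zero] at h₂
  simp only [add_zero] at h₂
  linarith

/-! ### Multiway trees represented by binary trees -/

section Represent

variable {α : Type u}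

mutual

/-- `Represents B b t φ`: the binary tree `t` represents the multiway tree `b`; every node of `b` is
a connected region of `t`. The potential `φ` is the excess over the least potential, summed over
the regions. -/
inductive Represents (B : ℕ) : BTree α → BinaryTree α → ℝ → Prop
  | nil : Represents B .nil .nil 0
  | node {ks : List α} {cs : List (BTree α)} {t : BinaryTree α} {φ φ' : ℝ} : ks ≠ [] →
      ks.length + 1 ≤ B → Region B ks cs t φ → φ' = φ - minPot ks.length →
      Represents B (.node ks cs) t φ'

/-- `Region B ks cs t φ`: the binary tree `t` is a region with the keys `ks`, below which there are
representations of the multiway trees `cs`. -/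
inductive Region (B : ℕ) : List α → List (BTree α) → BinaryTree α → ℝ → Prop
  | leaf {c : BTree α} {t : BinaryTree α} {φ : ℝ} : Represents B c t φ → Region B [] [c] t φ
  | node {ks₁ ks₂ ks : List α} {cs₁ cs₂ cs : List (BTree α)} {k : α} {l r : BinaryTree α}
      {φ₁ φ₂ φ : ℝ} : Region B ks₁ cs₁ l φ₁ → Region B ks₂ cs₂ r φ₂ → ks = ks₁ ++ k :: ks₂ →
      cs = cs₁ ++ cs₂ → φ = φ₁ + φ₂ + lg (ks₁.length + ks₂.length + 1) →
      Region B ks cs (.node k l r) φ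

end

/-- `RegionPath B h F L CL R CR φ`: the frames `F` form the path from a subtree with `h` keys of a
region up to the root of the region; `L`, `CL`, `R`, `CR` are the keys of the region and the
multiway trees below it to the left and to the right of the subtree. -/
inductive RegionPath (B : ℕ) : ℕ → List (BSTFrame α) → List α → List (BTree α) → List α →
    List (BTree α) → ℝ → Prop
  | nil {h : ℕ} : RegionPath B h [] [] [] [] [] 0
  | left {h h' : ℕ} {F : List (BSTFrame α)} {L R R' ks : List α} {CL CR CR' cs : List (BTree α)}
      {k : α} {r : BinaryTree α} {φ ψ φ' : ℝ} : Region B ks cs r φ →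
      RegionPath B h' F L CL R CR ψ → h' = h + ks.length + 1 → R' = k :: ks ++ R →
      CR' = cs ++ CR → φ' = φ + ψ + lg h' → RegionPath B h (.left k r :: F) L CL R' CR' φ'
  | right {h h' : ℕ} {F : List (BSTFrame α)} {L L' R ks : List α} {CL CL' CR cs : List (BTree α)}
      {k : α} {l : BinaryTree α} {φ ψ φ' : ℝ} : Region B ks cs l φ →
      RegionPath B h' F L CL R CR ψ → h' = h + ks.length + 1 → L' = L ++ ks ++ [k] →
      CL' = CL ++ cs → φ' = φ + ψ + lg h' → RegionPath B h (.right k l :: F) L' CL' R CR φ'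

-- Basic properties of regions and representations.

variable {B : ℕ}

lemma Region.length_eq {t : BinaryTree α} {ks : List α} {cs : List (BTree α)} {φ : ℝ}
    (h : Region B ks cs t φ) : cs.length = ks.length + 1 := by
  induction t generalizing ks cs φ with
  | nil => cases h; rfl
  | node k l r ihl ihr =>
    cases h with
    | leaf => rfl
    | node hl hr hk hc =>
      subst hk hc
      simp [ihl hl, ihr hr]
      omega

lemma RegionPath.length_eq {h : ℕ} {F : List (BSTFrame α)} {L R : List α}
    {CL CR : List (BTree α)} {φ : ℝ} (hF : RegionPath B h F L CL R CR φ) :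
    CL.length = L.length ∧ CR.length = R.length := by
  induction hF with
  | nil => simp
  | left hr _ _ hR hC _ ih =>
    subst hR hC
    simp [ih, hr.length_eq]
    omega
  | right hl _ _ hL hC _ ih =>
    subst hL hC
    simp [ih, hl.length_eq]

lemma Region.ne_nil {t : BinaryTree α} {ks : List α} {cs : List (BTree α)} {φ : ℝ}
    (h : Region B ks cs t φ) (hks : ks ≠ []) : ∃ k l r, t = .node k l r := by
  cases h with
  | leaf => simp at hks
  | node => exact ⟨_, _, _, rfl⟩

lemma Region.of_nil {t : BinaryTree α} {c : BTree α} {φ : ℝ}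
    (h : Region B [] [c] t φ) : Represents B c t φ := by
  cases h with
  | leaf h => exact h
  | node _ _ hk => simp at hk

lemma Region.of_node {t : BinaryTree α} {ks : List α} {cs : List (BTree α)} {φ : ℝ}
    (h : Region B [] [.node ks cs] t φ) : ks ≠ [] ∧ ks.length + 1 ≤ B ∧
      Region B ks cs t (φ + minPot ks.length) := by
  cases h.of_nil with
  | node h₁ h₂ h₃ h₄ => subst h₄; exact ⟨h₁, h₂, by simpa using h₃⟩

/-- A region is a shape whose own potential is at least `minPot`, and the representations hanging
below it contribute nonnegative excesses. The two claims depend on each other; induction on the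
binary tree handles both mutually inductive predicates at once. -/
lemma potential_nonneg_aux (t : BinaryTree α) :
    (∀ (b : BTree α) (φ : ℝ), Represents B b t φ → 0 ≤ φ) ∧
      ∀ (ks : List α) (cs : List (BTree α)) (φ : ℝ), Region B ks cs t φ →
        minPot ks.length ≤ φ := by
  induction t with
  | nil =>
    have h₁ : ∀ (b : BTree α) (φ : ℝ), Represents B b .nil φ → 0 ≤ φ := by
      intro b φ h
      cases h with
      | nil => rfl
      | node h₁ _ h₃ => obtain ⟨_, _, _, h⟩ := h₃.ne_nil h₁; cases h
    refine ⟨h₁, ?_⟩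
    intro ks cs φ h
    cases h with
    | leaf h => simpa [minPot_zero] using h₁ _ _ h
  | node k l r ihl ihr =>
    have h₀ : ∀ (ks : List α) (cs : List (BTree α)) (φ : ℝ), ks ≠ [] →
        Region B ks cs (.node k l r) φ → minPot ks.length ≤ φ := by
      intro ks cs φ hks h
      cases h with
      | leaf => simp at hks
      | @node ks₁ ks₂ _ _ _ _ _ _ _ φ₁ φ₂ _ hl hr hk hc hφ =>
        have := ihl.2 _ _ _ hl
        have := ihr.2 _ _ _ hr
        have := minPot_add_add_one_le ks₁.length ks₂.length
        have e : ks.length = ks₁.length + ks₂.length + 1 := by subst hk; simp; omega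
        rw [e]
        linarith
    have h₁ : ∀ (b : BTree α) (φ : ℝ), Represents B b (.node k l r) φ → 0 ≤ φ := by
      intro b φ h
      cases h with
      | node h₁ _ h₃ h₄ => have := h₀ _ _ _ h₁ h₃; linarith
    refine ⟨h₁, ?_⟩
    intro ks cs φ h
    rcases eq_or_ne ks [] with rfl | hks
    · cases h with
      | leaf h => simpa [minPot_zero] using h₁ _ _ h
      | node _ _ hk => simp at hk
    · exact h₀ _ _ _ hks h

lemma Represents.nonneg {b : BTree α} {t : BinaryTree α} {φ : ℝ} (h : Represents B b t φ) :
    0 ≤ φ :=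
  (potential_nonneg_aux t).1 b φ h

lemma BTree.keysInorderAux_append (ks₁ ks₂ : List α) (k : α) (cs₁ cs₂ : List (BTree α))
    (h : cs₁.length = ks₁.length + 1) :
    BTree.keysInorderAux (ks₁ ++ k :: ks₂) (cs₁ ++ cs₂) =
      BTree.keysInorderAux ks₁ cs₁ ++ k :: BTree.keysInorderAux ks₂ cs₂ := by
  induction cs₁ generalizing ks₁ with
  | nil => simp at h
  | cons c cs ih =>
    cases ks₁ with
    | nil =>
      have : cs = [] := by simpa using h
      subst this
      simp [BTree.keysInorderAux]
    | cons k' ks =>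
      simp only [List.length_cons, Nat.add_right_cancel_iff] at h
      simp [BTree.keysInorderAux, ih ks h]

/-- Needed so that the binary tree built for a valid initial B-tree is a search tree on the same
keys. -/
lemma keysInorder_eq_aux (t : BinaryTree α) :
    (∀ (b : BTree α) (φ : ℝ), Represents B b t φ → b.keysInorder = t.keysInorder) ∧
      ∀ (ks : List α) (cs : List (BTree α)) (φ : ℝ), Region B ks cs t φ →
        BTree.keysInorderAux ks cs = t.keysInorder := by
  induction t with
  | nil =>
    have h₁ : ∀ (b : BTree α) (φ : ℝ), Represents B b .nil φ →
        b.keysInorder = BinaryTree.nil.keysInorder := by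
      intro b φ h
      cases h with
      | nil => simp [BTree.keysInorder, BinaryTree.keysInorder]
      | node h₁ _ h₃ => obtain ⟨_, _, _, h⟩ := h₃.ne_nil h₁; cases h
    refine ⟨h₁, ?_⟩
    intro ks cs φ h
    cases h with
    | leaf h => simpa [BTree.keysInorderAux] using h₁ _ _ h
  | node k l r ihl ihr =>
    have h₀ : ∀ (ks : List α) (cs : List (BTree α)) (φ : ℝ), ks ≠ [] →
        Region B ks cs (.node k l r) φ →
          BTree.keysInorderAux ks cs = (BinaryTree.node k l r).keysInorder := by
      intro ks cs φ hks h
      cases h with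
      | leaf => simp at hks
      | node hl hr hk hc hφ =>
        subst hk hc
        rw [BTree.keysInorderAux_append _ _ _ _ _ hl.length_eq, ihl.2 _ _ _ hl, ihr.2 _ _ _ hr,
          BinaryTree.keysInorder]
    have h₁ : ∀ (b : BTree α) (φ : ℝ), Represents B b (.node k l r) φ →
        b.keysInorder = (BinaryTree.node k l r).keysInorder := by
      intro b φ h
      cases h with
      | node h₁ _ h₃ _ => rw [BTree.keysInorder, h₀ _ _ _ h₁ h₃]
    refine ⟨h₁, ?_⟩
    intro ks cs φ h
    rcases eq_or_ne ks [] with rfl | hks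
    · cases h with
      | leaf h => simpa [BTree.keysInorderAux] using h₁ _ _ h
      | node _ _ hk => simp at hk
    · exact h₀ _ _ _ hks h

lemma Represents.keysInorder_eq {b : BTree α} {t : BinaryTree α} {φ : ℝ}
    (h : Represents B b t φ) : b.keysInorder = t.keysInorder :=
  (keysInorder_eq_aux t).1 b φ h

/-- Every shape can be used for a region. -/
lemma exists_region (s : BinaryTree Unit) (ks : List α) (cs : List (BTree α))
    (hs : s.numNodes = ks.length) (hc : cs.length = ks.length + 1)
    (h : ∀ c ∈ cs, ∃ t, Represents B c t 0) : ∃ t, Region B ks cs t s.potential := by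
  induction s generalizing ks cs with
  | nil =>
    have : ks = [] := by simpa [BinaryTree.numNodes, eq_comm] using hs
    subst this
    obtain ⟨c, rfl⟩ := List.length_eq_one_iff.1 (by simpa using hc)
    obtain ⟨t, ht⟩ := h c (by simp)
    exact ⟨t, .leaf ht⟩
  | node _ l r ihl ihr =>
    simp only [BinaryTree.numNodes] at hs
    have hlt : l.numNodes < ks.length := by omega
    have hk : ks = ks.take l.numNodes ++ ks[l.numNodes] :: ks.drop (l.numNodes + 1) := by simp
    obtain ⟨tl, htl⟩ := ihl (ks.take l.numNodes) (cs.take (l.numNodes + 1))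
      (by simp; omega) (by simp; omega) (fun c hc => h c (List.mem_of_mem_take hc))
    obtain ⟨tr, htr⟩ := ihr (ks.drop (l.numNodes + 1)) (cs.drop (l.numNodes + 1))
      (by simp; omega) (by simp; omega) (fun c hc => h c (List.mem_of_mem_drop hc))
    refine ⟨_, .node htl htr hk (by simp) ?_⟩
    have e₁ : (ks.take l.numNodes).length = l.numNodes := by simp; omega
    have e₂ : (ks.drop (l.numNodes + 1)).length = r.numNodes := by simp; omega
    rw [BinaryTree.potential, e₁, e₂]

/-- Every node receives a shape of least potential, so all excesses vanish. -/
lemma BTree.WellFormed.exists_represents {b : BTree α} (hb : b.WellFormed B) :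
    ∃ t, Represents B b t 0 := by
  induction hb with
  | nil => exact ⟨_, .nil⟩
  | node ks cs h₁ h₂ h₃ _ ih =>
    obtain ⟨s, hs, hs'⟩ := exists_potential_eq_minPot ks.length
    obtain ⟨t, ht⟩ := exists_region s ks cs hs h₃ ih
    exact ⟨t, .node h₁ h₂ ht (by rw [hs', sub_self])⟩

lemma represents_toBTree (hB : 2 ≤ B) (t : BinaryTree α) : Represents B t.toBTree t 0 := by
  induction t with
  | nil => exact .nil
  | node k l r ihl ihr =>
    exact .node (by simp) (by simpa using hB)
      (.node (.leaf ihl) (.leaf ihr) (by simp) (by simp) rfl) (by simp [lg_one, minPot_one])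

end Represent

/-! ### Executions of the BST model -/

section Splay

variable {α : Type u}

lemma PointerModel.Steps.trans {M : PointerModel α} {m n : ℕ} {s s' s'' : M.State}
    (h : M.Steps m s s') (h' : M.Steps n s' s'') : M.Steps (m + n) s s'' := by
  induction h' with
  | refl => exact h
  | tail _ hs ih => exact .tail (ih h) hs

/-- Some `n` unit-cost operations of the BST model lead from `s` to `s'`. -/
def BSTSteps (n : ℕ) (s s' : BSTState α) : Prop := (bstModel α).Steps n s s'

lemma BSTSteps.refl (s : BSTState α) : BSTSteps 0 s s := PointerModel.Steps.refl (M := bstModel α) s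

lemma BSTSteps.trans {m n : ℕ} {s s' s'' : BSTState α} (h : BSTSteps m s s')
    (h' : BSTSteps n s' s'') : BSTSteps (m + n) s s'' :=
  PointerModel.Steps.trans (M := bstModel α) h h'

lemma BSTStep.steps {s s' : BSTState α} (h : BSTStep s s') : BSTSteps 1 s s' :=
  PointerModel.Steps.tail (M := bstModel α) (BSTSteps.refl s) h

lemma BSTSteps.up (t : BinaryTree α) (F F₀ : List (BSTFrame α)) :
    BSTSteps F.length ⟨t, F ++ F₀⟩ ⟨F.foldl (fun t f => f.fill t) t, F₀⟩ := by
  induction F generalizing t with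
  | nil => exact .refl _
  | cons f F ih =>
    have := (BSTStep.moveUp t f (F ++ F₀)).steps.trans (ih (f.fill t))
    simpa [add_comm] using this

variable {B : ℕ}

/-- Splaying a node to the root of its region. The cost includes that of the way from the root. -/
lemma exists_splay (F : List (BSTFrame α)) (F₀ : List (BSTFrame α)) (x : α) {l r : BinaryTree α}
    {A D L R : List α} {C₁ C₂ CL CR : List (BTree α)} {φl φr φc : ℝ}
    (hl : Region B A C₁ l φl) (hr : Region B D C₂ r φr)
    (hF : RegionPath B (A.length + D.length + 1) F L CL R CR φc) :
    ∃ (n : ℕ) (l' r' : BinaryTree α) (φl' φr' : ℝ),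
      BSTSteps n ⟨.node x l r, F ++ F₀⟩ ⟨.node x l' r', F₀⟩ ∧
      Region B (L ++ A) (CL ++ C₁) l' φl' ∧ Region B (D ++ R) (C₂ ++ CR) r' φr' ∧
      n + F.length + φl' + φr' + lg (L.length + A.length + D.length + R.length + 1) ≤
        φl + φr + φc + lg (A.length + D.length + 1) +
          3 * (lg (L.length + A.length + D.length + R.length + 1) -
            lg (A.length + D.length + 1)) + 3 := by
  match F with
  | [] =>
    cases hF
    refine ⟨0, l, r, φl, φr, .refl _, by simpa using hl, by simpa using hr, ?_⟩
    simp
  | [f] =>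
    cases hF with
    | left hk hF' hh hR hC hφ =>
      rename_i h' R₀ ks CR₀ cs k c φ ψ
      cases hF'
      subst hR hC hh hφ
      refine ⟨1, l, .node k r c, φl, φr + φ + lg (D.length + ks.length + 1),
        (BSTStep.rotateLeftChild x k l r c F₀).steps, by simpa using hl,
        .node hr hk (by simp) (by simp) rfl, ?_⟩
      have h₁ := lg_mono (show D.length + ks.length + 1 ≤
        A.length + D.length + 1 + ks.length + 1 by omega)
      have h₂ := lg_mono (show A.length + D.length + 1 ≤
        A.length + D.length + 1 + ks.length + 1 by omega)
      have e : ([] : List α).length + A.length + D.length + (k :: ks ++ []).length + 1 =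
        A.length + D.length + 1 + ks.length + 1 := by simp; omega
      rw [e]
      push_cast [List.length_singleton]
      linarith
    | right hk hF' hh hR hC hφ =>
      rename_i h' R₀ ks CR₀ cs k c φ ψ
      cases hF'
      subst hR hC hh hφ
      refine ⟨1, .node k c l, r, φ + φl + lg (ks.length + A.length + 1), φr,
        (BSTStep.rotateRightChild x k c l r F₀).steps, .node hk hl (by simp) (by simp) rfl,
        by simpa using hr, ?_⟩
      have h₁ := lg_mono (show ks.length + A.length + 1 ≤
        A.length + D.length + 1 + ks.length + 1 by omega)
      have h₂ := lg_mono (show A.length + D.length + 1 ≤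
        A.length + D.length + 1 + ks.length + 1 by omega)
      have e : ([] ++ ks ++ [k]).length + A.length + D.length + ([] : List α).length + 1 =
        A.length + D.length + 1 + ks.length + 1 := by simp; omega
      rw [e]
      push_cast [List.length_singleton]
      linarith
  | f :: g :: F =>
    cases hF with
    | left hp hF hh₁ hR hC hφ₁ =>
      rename_i h₁ R₁ ps CR₁ pc p c φp ψ₁
      cases hF with
      | left hg hF hh₂ hR' hC' hφ₂ =>
        rename_i h₂ R₂ gs CR₂ gc g d φg ψ₂
        have hr' : Region B (D ++ p :: ps ++ g :: gs) (C₂ ++ pc ++ gc)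
            (.node p r (.node g c d)) (φr + (φp + φg + lg (ps.length + gs.length + 1)) +
              lg (D.length + (ps.length + gs.length + 1) + 1)) :=
          .node hr (.node hp hg rfl rfl rfl) (by simp) (by simp) (by simp; ring_nf)
        have e : A.length + (D ++ p :: ps ++ g :: gs).length + 1 = h₂ := by
          simp; omega
        obtain ⟨n, l', r', φl', φr', hs, hl', hr', hn⟩ :=
          exists_splay F F₀ x hl hr' (e ▸ hF)
        subst hR hC hR' hC' hφ₁ hφ₂
        -- Zig-zig rotates the upper edge first. Only the edge above the pointer can be rotated, so
        -- the pointer steps up to `p`, rotates, and returns to `x`: four operations instead of two.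
        refine ⟨1 + (1 + (1 + (1 + n))), l', r', φl', φr',
          (BSTStep.moveUp _ _ _).steps.trans ((BSTStep.rotateLeftChild p g _ _ _ _).steps.trans
            ((BSTStep.moveLeft _ _ _ _ _ _).steps.trans
              ((BSTStep.rotateLeftChild x p _ _ _ _).steps.trans hs))), hl',
          by simpa using hr', ?_⟩
        -- The old subtree of `x` and the new subtree of `g` are disjoint inside the old subtree of
        -- `g`, of size `h₂`. The gain 6 pays for the four operations and for the two frames, that
        -- is, for the descent.
        have i₁ := lg_add_lg_le (a := A.length + D.length + 1) (b := ps.length + gs.length + 1)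
          (c := h₂) (by omega) (by omega) (by omega)
        have i₂ := lg_mono (show D.length + (ps.length + gs.length + 1) + 1 ≤ h₂ by omega)
        have i₃ := lg_mono (show A.length + D.length + 1 ≤ h₁ by omega)
        rw [e] at hn
        simp only [List.length_append, List.length_cons] at hn ⊢
        rw [show L.length + A.length + D.length + (ps.length + 1 + (gs.length + 1 + R₂.length)) + 1
          = L.length + A.length + (D.length + (ps.length + 1) + (gs.length + 1)) + R₂.length + 1
          by omega]
        push_cast
        linarith
      | right hg hF hh₂ hL' hC' hφ₂ =>
        rename_i h₂ L₂ gs CL₂ gc g d φg ψ₂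
        have hl' : Region B (gs ++ g :: A) (gc ++ C₁)
            (.node g d l) (φg + φl + lg (gs.length + A.length + 1)) :=
          .node hg hl rfl rfl rfl
        have hr' : Region B (D ++ p :: ps) (C₂ ++ pc)
            (.node p r c) (φr + φp + lg (D.length + ps.length + 1)) :=
          .node hr hp rfl rfl rfl
        have e : (gs ++ g :: A).length + (D ++ p :: ps).length + 1 = h₂ := by
          simp; omega
        obtain ⟨n, l', r', φl', φr', hs, hl', hr', hn⟩ :=
          exists_splay F F₀ x hl' hr' (e ▸ hF)
        subst hR hC hL' hC' hφ₁ hφ₂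
        refine ⟨1 + (1 + n), l', r', φl', φr',
          (BSTStep.rotateLeftChild x p _ _ _ _).steps.trans
            ((BSTStep.rotateRightChild x g _ _ _ _).steps.trans hs),
          by simpa using hl', by simpa using hr', ?_⟩
        -- Zig-zag: the new subtrees of `g` and `p` are disjoint. Two rotations and two frames need
        -- only 4 of the gain 6.
        have i₁ := lg_add_lg_le (a := gs.length + A.length + 1) (b := D.length + ps.length + 1)
          (c := h₂) (by omega) (by omega) (by omega)
        have i₂ := lg_mono (show A.length + D.length + 1 ≤ h₂ by omega)
        have i₃ := lg_mono (show A.length + D.length + 1 ≤ h₁ by omega)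
        rw [e] at hn
        simp only [List.length_append, List.length_cons, List.length_nil] at hn ⊢
        rw [show L₂.length + gs.length + (0 + 1) + A.length + D.length + (ps.length + 1 + R₁.length)
          + 1 = L₂.length + (gs.length + (A.length + 1)) + (D.length + (ps.length + 1)) + R₁.length
          + 1 by omega]
        push_cast
        linarith
    | right hp hF hh₁ hL hC hφ₁ =>
      rename_i h₁ L₁ ps CL₁ pc p c φp ψ₁
      cases hF with
      | left hg hF hh₂ hR' hC' hφ₂ =>
        rename_i h₂ R₂ gs CR₂ gc g d φg ψ₂
        have hl' : Region B (ps ++ p :: A) (pc ++ C₁)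
            (.node p c l) (φp + φl + lg (ps.length + A.length + 1)) :=
          .node hp hl rfl rfl rfl
        have hr' : Region B (D ++ g :: gs) (C₂ ++ gc)
            (.node g r d) (φr + φg + lg (D.length + gs.length + 1)) :=
          .node hr hg rfl rfl rfl
        have e : (ps ++ p :: A).length + (D ++ g :: gs).length + 1 = h₂ := by
          simp; omega
        obtain ⟨n, l', r', φl', φr', hs, hl', hr', hn⟩ :=
          exists_splay F F₀ x hl' hr' (e ▸ hF)
        subst hL hC hR' hC' hφ₁ hφ₂
        refine ⟨1 + (1 + n), l', r', φl', φr',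
          (BSTStep.rotateRightChild x p _ _ _ _).steps.trans
            ((BSTStep.rotateLeftChild x g _ _ _ _).steps.trans hs),
          by simpa using hl', by simpa using hr', ?_⟩
        have i₁ := lg_add_lg_le (a := ps.length + A.length + 1) (b := D.length + gs.length + 1)
          (c := h₂) (by omega) (by omega) (by omega)
        have i₂ := lg_mono (show A.length + D.length + 1 ≤ h₂ by omega)
        have i₃ := lg_mono (show A.length + D.length + 1 ≤ h₁ by omega)
        rw [e] at hn
        simp only [List.length_append, List.length_cons, List.length_nil] at hn ⊢
        rw [show L₁.length + ps.length + (0 + 1) + A.length + D.length + (gs.length + 1 + R₂.length)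
          + 1 = L₁.length + (ps.length + (A.length + 1)) + (D.length + (gs.length + 1)) + R₂.length
          + 1 by omega]
        push_cast
        linarith
      | right hg hF hh₂ hL' hC' hφ₂ =>
        rename_i h₂ L₂ gs CL₂ gc g d φg ψ₂
        have hl' : Region B (gs ++ g :: ps ++ p :: A) (gc ++ pc ++ C₁)
            (.node p (.node g d c) l) ((φg + φp + lg (gs.length + ps.length + 1)) + φl +
              lg ((gs.length + ps.length + 1) + A.length + 1)) :=
          .node (.node hg hp rfl rfl rfl) hl (by simp) (by simp) (by simp; ring_nf)
        have e : (gs ++ g :: ps ++ p :: A).length + D.length + 1 = h₂ := by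
          simp; omega
        obtain ⟨n, l', r', φl', φr', hs, hl', hr', hn⟩ :=
          exists_splay F F₀ x hl' hr (e ▸ hF)
        subst hL hC hL' hC' hφ₁ hφ₂
        refine ⟨1 + (1 + (1 + (1 + n))), l', r', φl', φr',
          (BSTStep.moveUp _ _ _).steps.trans ((BSTStep.rotateRightChild p g _ _ _ _).steps.trans
            ((BSTStep.moveRight _ _ _ _ _ _).steps.trans
              ((BSTStep.rotateRightChild x p _ _ _ _).steps.trans hs))),
          by simpa using hl', hr', ?_⟩
        have i₁ := lg_add_lg_le (a := A.length + D.length + 1) (b := gs.length + ps.length + 1)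
          (c := h₂) (by omega) (by omega) (by omega)
        have i₂ := lg_mono (show gs.length + ps.length + 1 + A.length + 1 ≤ h₂ by omega)
        have i₃ := lg_mono (show A.length + D.length + 1 ≤ h₁ by omega)
        rw [e] at hn
        simp only [List.length_append, List.length_cons, List.length_nil] at hn ⊢
        rw [show L₂.length + gs.length + (0 + 1) + ps.length + (0 + 1) + A.length + D.length
          + R.length + 1 = L₂.length + (gs.length + (ps.length + 1) + (A.length + 1)) + D.length
          + R.length + 1 by omega]
        push_cast
        linarith
termination_by F.length

end Splay

-- Accessing a key and exposing an interval of keys.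

section Access

variable {α : Type u} {B : ℕ}

lemma append_cons_eq_append_cons {A D A' D' : List α} {x y : α}
    (h : A ++ x :: D = A' ++ y :: D') :
    (A = A' ∧ x = y ∧ D = D') ∨ (∃ E, A' = A ++ x :: E ∧ D = E ++ y :: D') ∨
      ∃ E, A = A' ++ y :: E ∧ D' = E ++ x :: D := by
  rcases List.append_eq_append_iff.1 h with ⟨E, h₁, h₂⟩ | ⟨E, h₁, h₂⟩
  · cases E with
    | nil => simp at h₁ h₂; simp_all
    | cons e E => simp at h₂; right; left; exact ⟨E, by simp_all, h₂.2⟩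
  · cases E with
    | nil => simp at h₁ h₂; simp_all
    | cons e E => simp at h₂; right; right; exact ⟨E, by simp_all, h₂.2⟩

/-- A key of a region is found in a subtree and splayed to the root of the region. -/
lemma exists_access_of_path (t : BinaryTree α) (F : List (BSTFrame α)) (F₀ : List (BSTFrame α))
    (x : α) {A D L R : List α} {C CL CR : List (BTree α)} {φ φc : ℝ}
    (ht : Region B (A ++ x :: D) C t φ)
    (hF : RegionPath B (A.length + D.length + 1) F L CL R CR φc) :
    ∃ (n : ℕ) (l r : BinaryTree α) (C₁ C₂ : List (BTree α)) (φl φr : ℝ),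
      BSTSteps n ⟨t, F ++ F₀⟩ ⟨.node x l r, F₀⟩ ∧
      Region B (L ++ A) C₁ l φl ∧ Region B (D ++ R) C₂ r φr ∧ C₁ ++ C₂ = CL ++ C ++ CR ∧
      n + F.length + φl + φr + lg (L.length + A.length + D.length + R.length + 1) ≤
        φ + φc + 3 * lg (L.length + A.length + D.length + R.length + 1) + 3 := by
  induction t generalizing F A D L R C CL CR φ φc with
  | nil => obtain ⟨_, _, _, h⟩ := ht.ne_nil (by simp); cases h
  | node y l r ihl ihr =>
    generalize hks : A ++ x :: D = ks at ht
    cases ht with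
    | leaf => simp at hks
    | node hl hr hk hC hφ =>
      rename_i A' D' C₁ C₂ φl φr
      rw [hk] at hks
      subst hk hC hφ
      rcases append_cons_eq_append_cons hks with ⟨rfl, rfl, rfl⟩ | ⟨E, rfl, rfl⟩ | ⟨E, rfl, rfl⟩
      · obtain ⟨n, l', r', φl', φr', hs, hl', hr', hn⟩ := exists_splay F F₀ x hl hr hF
        refine ⟨n, l', r', _, _, φl', φr', hs, hl', hr', by simp, ?_⟩
        have := lg_nonneg (A.length + D.length + 1)
        linarith
      · obtain ⟨k, l₁, l₂, rfl⟩ := hl.ne_nil (by simp)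
        have e : A.length + (E ++ y :: D').length + 1 =
          A.length + E.length + 1 + D'.length + 1 := by simp; omega
        obtain ⟨n, l', r', C₁', C₂', φl', φr', hs, hl', hr', hC', hn⟩ :=
          ihl (.left y r :: F) hl (.left hr hF e rfl rfl rfl)
        refine ⟨1 + n, l', r', C₁', C₂', φl', φr',
          (BSTStep.moveLeft _ _ _ _ _ _).steps.trans hs, hl', by simpa using hr',
          by simpa using hC', ?_⟩
        simp only [List.length_append, List.length_cons] at hn ⊢
        rw [show L.length + A.length + E.length + (D'.length + 1 + R.length) + 1 =
          L.length + A.length + (E.length + (D'.length + 1)) + R.length + 1 by omega,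
          show A.length + (E.length + (D'.length + 1)) + 1 =
            A.length + (E.length + 1) + D'.length + 1 by omega] at hn
        push_cast at hn ⊢
        linarith
      · obtain ⟨k, l₁, l₂, rfl⟩ := hr.ne_nil (by simp)
        have e : (A' ++ y :: E).length + D.length + 1 =
          E.length + D.length + 1 + A'.length + 1 := by simp; omega
        obtain ⟨n, l', r', C₁', C₂', φl', φr', hs, hl', hr', hC', hn⟩ :=
          ihr (.right y l :: F) hr (.right hl hF e rfl rfl rfl)
        refine ⟨1 + n, l', r', C₁', C₂', φl', φr',
          (BSTStep.moveRight _ _ _ _ _ _).steps.trans hs, by simpa using hl', hr',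
          by simpa using hC', ?_⟩
        simp only [List.length_append, List.length_cons, List.length_nil] at hn ⊢
        rw [show L.length + A'.length + (0 + 1) + E.length + D.length + R.length + 1 =
          L.length + (A'.length + (E.length + 1)) + D.length + R.length + 1 by omega,
          show A'.length + (E.length + 1) + D.length + 1 =
            A'.length + (E.length + (D.length + 1)) + 1 by omega] at hn
        push_cast at hn ⊢
        linarith

/-- A key of a region is found and splayed to the root of the region. -/
lemma exists_access {t : BinaryTree α} (F₀ : List (BSTFrame α)) {x : α} {A D : List α}
    {C : List (BTree α)} {φ : ℝ} (ht : Region B (A ++ x :: D) C t φ) :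
    ∃ (n : ℕ) (l r : BinaryTree α) (C₁ C₂ : List (BTree α)) (φl φr : ℝ),
      BSTSteps n ⟨t, F₀⟩ ⟨.node x l r, F₀⟩ ∧
      Region B A C₁ l φl ∧ Region B D C₂ r φr ∧ C₁ ++ C₂ = C ∧
      n + φl + φr + lg (A.length + D.length + 1) ≤
        φ + 3 * lg (A.length + D.length + 1) + 3 := by
  obtain ⟨n, l, r, C₁, C₂, φl, φr, hs, hl, hr, hC, hn⟩ :=
    exists_access_of_path t [] F₀ x ht .nil
  refine ⟨n, l, r, C₁, C₂, φl, φr, hs, by simpa using hl, by simpa using hr,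
    by simpa using hC, ?_⟩
  simpa using hn

/-- The frames' logarithms were computed for exactly `h` keys in the hole, so filling it with that
many keys simply adds the potentials. -/
lemma RegionPath.plug {F : List (BSTFrame α)} {L R : List α} {CL CR : List (BTree α)} {h : ℕ}
    {φc : ℝ} (hF : RegionPath B h F L CL R CR φc) {t : BinaryTree α} {ks : List α}
    {cs : List (BTree α)} {φ : ℝ} (ht : Region B ks cs t φ) (hks : ks.length = h) :
    Region B (L ++ ks ++ R) (CL ++ cs ++ CR) (F.foldl (fun t f => f.fill t) t) (φ + φc) := by
  induction hF generalizing t ks cs φ with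
  | nil => simpa using ht
  | left hr hF hh hR hC hφ ih =>
    rename_i k r _ _ _
    subst hR hC hφ
    have := ih (.node ht hr rfl rfl rfl : Region B _ _ (.node k t r) _) (by simp; omega)
    simp only [List.append_assoc, List.cons_append, List.foldl_cons, BSTFrame.fill] at this ⊢
    convert this using 1
    rw [hh, hks]
    ring
  | right hl hF hh hR hC hφ ih =>
    rename_i ks' _ _ _ _ k l _ _ _
    subst hR hC hφ
    have := ih (.node hl ht rfl rfl rfl : Region B _ _ (.node k l t) _) (by simp; omega)
    simp only [List.append_assoc, List.cons_append, List.nil_append, List.foldl_cons, BSTFrame.fill] at this ⊢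
    convert this using 1
    rw [hh, hks, add_comm ks'.length]
    ring

/-- The number of keys in the hole can be changed. -/
lemma RegionPath.exists_change {F : List (BSTFrame α)} {L R : List α} {CL CR : List (BTree α)}
    {h : ℕ} {φ : ℝ} (hF : RegionPath B h F L CL R CR φ) (h' : ℕ) :
    ∃ φ', RegionPath B h' F L CL R CR φ' ∧
      φ' ≤ φ + F.length * lg (h' + L.length + R.length) ∧ (h' ≤ h → φ' ≤ φ) := by
  induction hF generalizing h' with
  | nil => exact ⟨0, .nil, by simp, fun _ => le_rfl⟩
  | left hr hF hh hR hC hφ ih =>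
    rename_i h₁ h₂ F L R R' ks _ _ _ _ _ _ φ ψ φ'
    obtain ⟨ψ', hψ, hle, hmono⟩ := ih (h' + ks.length + 1)
    refine ⟨_, .left hr hψ rfl hR hC rfl, ?_, ?_⟩
    · have h₁ := lg_mono (show h' + ks.length + 1 ≤ h' + L.length + R'.length by
        subst hR; simp; omega)
      have h₂ := lg_nonneg h₂
      rw [show h' + ks.length + 1 + L.length + R.length = h' + L.length + R'.length by
        subst hR; simp; omega] at hle
      push_cast [List.length_cons]
      linarith
    · intro hle'
      have := hmono (by omega)
      have := lg_mono (show h' + ks.length + 1 ≤ h₂ by omega)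
      linarith
  | right hl hF hh hR hC hφ ih =>
    rename_i h₁ h₂ F L L' R ks _ _ _ _ _ _ φ ψ φ'
    obtain ⟨ψ', hψ, hle, hmono⟩ := ih (h' + ks.length + 1)
    refine ⟨_, .right hl hψ rfl hR hC rfl, ?_, ?_⟩
    · have h₁ := lg_mono (show h' + ks.length + 1 ≤ h' + L'.length + R.length by
        subst hR; simp; omega)
      have h₂ := lg_nonneg h₂
      rw [show h' + ks.length + 1 + L.length + R.length = h' + L'.length + R.length by
        subst hR; simp; omega] at hle
      push_cast [List.length_cons]
      linarith
    · intro hle'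
      have := hmono (by omega)
      have := lg_mono (show h' + ks.length + 1 ≤ h₂ by omega)
      linarith

/-- The first key of `R` is splayed to the root; its left subtree is then exactly the region of `U`.
The path is stated relative to arbitrary further frames because the lemma is also applied below the
key that bounds the interval on the left. -/
lemma exists_expose_prefix {t : BinaryTree α} (F₀ : List (BSTFrame α)) {U R : List α}
    {CU CR : List (BTree α)} {φ : ℝ} (ht : Region B (U ++ R) (CU ++ CR) t φ)
    (hU : CU.length = U.length + 1) (hR : CR.length = R.length)
    (hne : ∀ s φ, Region B U CU s φ → s ≠ .nil) :
    ∃ (n : ℕ) (s : BinaryTree α) (F : List (BSTFrame α)) (φ₁ φ₂ : ℝ),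
      BSTSteps n ⟨t, F₀⟩ ⟨s, F ++ F₀⟩ ∧ Region B U CU s φ₁ ∧ F.length ≤ 1 ∧
      (∀ h F' L CL R' CR' ψ, h = U.length + R.length → RegionPath B h F' L CL R' CR' ψ →
        RegionPath B U.length (F ++ F') L CL (R ++ R') (CR ++ CR') (φ₂ + ψ)) ∧
      n + φ₁ + φ₂ ≤ φ + 3 * lg (U.length + R.length) + 4 := by
  cases R with
  | nil =>
    obtain rfl : CR = [] := by simpa using hR
    simp only [List.append_nil] at ht
    refine ⟨0, t, [], φ, 0, .refl _, ht, by simp, ?_, ?_⟩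
    · rintro h F' L CL R' CR' ψ rfl hF'
      simpa using hF'
    · have := lg_nonneg (U.length + ([] : List α).length)
      push_cast
      linarith
  | cons y R =>
    obtain ⟨n, l, r, C₁, C₂, φl, φr, hs, hl, hr, hC, hn⟩ := exists_access F₀ ht
    obtain ⟨rfl, rfl⟩ := List.append_inj hC (by rw [hl.length_eq, hU])
    have hln := hne _ _ hl
    cases l with
    | nil => exact absurd rfl hln
    | node k l₁ l₂ =>
      refine ⟨n + 1, _, [.left y r], φl, φr + lg (U.length + R.length + 1),
        hs.trans (BSTStep.moveLeft _ _ _ _ _ _).steps, hl, by simp, ?_, ?_⟩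
      · rintro h F' L CL R' CR' ψ rfl hF'
        exact .left hr hF' rfl rfl rfl (by
          rw [List.length_cons, show U.length + (R.length + 1) = U.length + R.length + 1 by omega]
          ring)
      · push_cast
        rw [List.length_cons, show U.length + (R.length + 1) = U.length + R.length + 1 by omega]
        linarith

/-- The pointer moves from the root of a region to a subtree with a given interval of keys, which
has at most two ancestors in the region then. -/
lemma exists_expose {t : BinaryTree α} (F₀ : List (BSTFrame α)) {L U R : List α}
    {CL CU CR : List (BTree α)} {φ : ℝ}
    (ht : Region B (L ++ U ++ R) (CL ++ CU ++ CR) t φ) (hL : CL.length = L.length)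
    (hU : CU.length = U.length + 1) (hR : CR.length = R.length)
    (hne : ∀ s φ, Region B U CU s φ → s ≠ .nil) :
    ∃ (n : ℕ) (s : BinaryTree α) (F : List (BSTFrame α)) (φ₁ φ₂ : ℝ),
      BSTSteps n ⟨t, F₀⟩ ⟨s, F ++ F₀⟩ ∧ Region B U CU s φ₁ ∧ F.length ≤ 2 ∧
      RegionPath B U.length F L CL R CR φ₂ ∧
      n + φ₁ + φ₂ ≤ φ + 6 * lg (L.length + U.length + R.length) + 8 := by
  have hpos := lg_nonneg (L.length + U.length + R.length)
  rcases List.eq_nil_or_concat L with rfl | ⟨L, x, rfl⟩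
  · obtain rfl : CL = [] := by simpa using hL
    simp only [List.nil_append] at ht
    obtain ⟨n, s, F, φ₁, φ₂, hs, hUs, hF, hF', hn⟩ := exists_expose_prefix F₀ ht hU hR hne
    refine ⟨n, s, F, φ₁, φ₂, hs, hUs, by omega, by simpa using hF' _ _ _ _ _ _ _ rfl .nil, ?_⟩
    simp only [List.length_nil, zero_add] at hpos ⊢
    linarith
  · simp only [List.append_assoc, List.concat_eq_append, List.cons_append,
      List.nil_append] at ht
    simp only [List.length_append, List.concat_eq_append, List.length_singleton] at hL hpos ⊢
    obtain ⟨n, l, r, C₁, C₂, φl, φr, hs, hl, hr, hC, hn⟩ := exists_access F₀ ht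
    obtain ⟨rfl, rfl⟩ := List.append_inj hC (by rw [hl.length_eq, hL])
    -- If `r` were null, `U` and `R` would be empty, so `r` itself would be the exposed subtree,
    -- contradicting `hne`.
    obtain ⟨k, r₁, r₂, rfl⟩ : ∃ k r₁ r₂, r = .node k r₁ r₂ := by
      rcases r with _ | ⟨k, r₁, r₂⟩
      · have hRn : U ++ R = [] := by
          by_contra h
          obtain ⟨_, _, _, h⟩ := hr.ne_nil h
          cases h
        simp only [List.append_eq_nil_iff] at hRn
        obtain ⟨rfl, rfl⟩ := hRn
        obtain rfl : CR = [] := by simpa using hR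
        exact absurd rfl (hne _ _ (by simpa using hr))
      · exact ⟨k, r₁, r₂, rfl⟩
    obtain ⟨n', s, F, φ₁, φ₂, hs', hUs, hF, hF', hn'⟩ :=
      exists_expose_prefix (.right x l :: F₀) hr hU hR hne
    refine ⟨n + (1 + n'), s, F ++ [.right x l], φ₁,
      φ₂ + (φl + 0 + lg (U.length + R.length + L.length + 1)), ?_, hUs, by simpa using hF, ?_, ?_⟩
    · simpa using hs.trans ((BSTStep.moveRight _ _ _ _ _ _).steps.trans hs')
    · have := hF' _ _ _ _ _ _ _ rfl (.right (k := x) hl .nil rfl rfl rfl rfl)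
      simpa using this
    · have := lg_mono (show U.length + R.length ≤ L.length + 1 + U.length + R.length by omega)
      rw [List.length_append, show L.length + (U.length + R.length) + 1 =
        L.length + 1 + U.length + R.length by omega] at hn
      rw [show U.length + R.length + L.length + 1 = L.length + 1 + U.length + R.length by omega]
      push_cast
      linarith

end Access

/-! ### Simulation of the B-tree model -/

section Simulate

variable {α : Type u} {B : ℕ}

/-- The ancestors of the current node of a multiway tree, represented by the ancestors of the
current node of a binary tree. -/
inductive RepresentsPath (B : ℕ) : List (BTreeFrame α) → List (BSTFrame α) → ℝ → Prop
  | nil : RepresentsPath B [] [] 0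
  | cons {L R : List α} {CL CR : List (BTree α)} {G : List (BTreeFrame α)}
      {F F' F'' : List (BSTFrame α)} {φ ψ φ' : ℝ} : L ++ R ≠ [] →
      (L ++ R).length + 1 ≤ B → RegionPath B 0 F L CL R CR φ → RepresentsPath B G F' ψ →
      F'' = F ++ F' → φ' = φ - minPot (L ++ R).length + ψ →
      RepresentsPath B (⟨L, CL, R, CR⟩ :: G) F'' φ'

/-- The pointer of the binary tree is at the root of the region of the current node. The number of
keys of that node is arbitrary. -/
inductive AtNode (B : ℕ) : BTreeState α → BSTState α → ℝ → Prop
  | mk {ks : List α} {cs : List (BTree α)} {G : List (BTreeFrame α)} {t : BinaryTree α}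
      {F : List (BSTFrame α)} {φ₁ φ₂ φ : ℝ} : Region B ks cs t φ₁ → RepresentsPath B G F φ₂ →
      φ = φ₁ - minPot ks.length + φ₂ → AtNode B ⟨.node ks cs, G⟩ ⟨t, F⟩ φ

/-- From any representation of `s` a representation of `s'` can be reached at amortized cost `c`. -/
def Amortized (B : ℕ) (c : ℝ) (s s' : BTreeState α) : Prop :=
  ∀ σ φ, AtNode B s σ φ → ∃ (n : ℕ) (σ' : BSTState α) (φ' : ℝ), BSTSteps n σ σ' ∧
    AtNode B s' σ' φ' ∧ n + φ' ≤ φ + c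

lemma Amortized.trans {c d e : ℝ} {s s' s'' : BTreeState α} (h : Amortized B c s s')
    (h' : Amortized B d s' s'') (he : c + d ≤ e) : Amortized B e s s'' := by
  intro σ φ hσ
  obtain ⟨m, σ', φ', hs, hσ', hm⟩ := h σ φ hσ
  obtain ⟨n, σ'', φ'', hs', hσ'', hn⟩ := h' σ' φ' hσ'
  refine ⟨m + n, σ'', φ'', hs.trans hs', hσ'', ?_⟩
  push_cast
  linarith

/-- The unit of the amortized costs: it bounds `1` and the logarithmic sizes. -/
def IsUnitBound (B : ℕ) (w : ℝ) : Prop := 1 ≤ w ∧ ∀ n ≤ 2 * B + 1, lg n ≤ w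

variable {w : ℝ}

/-- The root of the child's region may hang deep in the parent's region. One step reaches the key
above it, and splaying that key brings the pointer to the root of the parent's region at amortized
cost O(log B). -/
lemma amortized_moveUp (hw : IsUnitBound B w) {U L R : List α} {CU CL CR : List (BTree α)}
    {G : List (BTreeFrame α)} (hU : U ≠ []) (hUB : U.length + 1 ≤ B) :
    Amortized B (7 * w) ⟨.node U CU, ⟨L, CL, R, CR⟩ :: G⟩
      ⟨.node (L ++ R) (CL ++ .node U CU :: CR), G⟩ := by
  rintro _ φ ⟨ht, hP, hφ⟩
  rename_i t F φ₁ φ₂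
  cases hP with
  | cons hLR hLRB hF hG hF'' hφ' =>
    rename_i F₁ F₂ φF φG
    subst hF'' hφ' hφ
    -- For the parent's region the whole child is a leaf with no keys.
    have htn : Region B [] [.node U CU] t (φ₁ - minPot U.length) :=
      .leaf (.node hU hUB ht rfl)
    have hlg := hw.2 (L.length + R.length) (by simp at hLRB; omega)
    have h1 := hw.1
    cases hF with
    | nil => simp at hLR
    | left hr hF hh hR hC hφ =>
      rename_i h' F R' ks CR' cs k r φr ψ
      subst hR hC hφ
      obtain ⟨n, l', r', φl', φr', hs, hl', hr', hn⟩ := exists_splay F F₂ k htn hr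
        (by subst hh; simpa [add_comm] using hF)
      refine ⟨1 + n, _, _, (BSTStep.moveUp t (.left k r) (F ++ F₂)).steps.trans hs,
        .mk (φ₁ := φl' + φr' + lg ((L ++ []).length + (ks ++ R').length + 1))
          (.node hl' hr' (by simp) (by simp) rfl) hG rfl, ?_⟩
      have h₂ := lg_nonneg (([] : List α).length + ks.length + 1)
      have h₃ : lg h' = lg (([] : List α).length + ks.length + 1) := by simp [hh]
      have h₄ := lg_nonneg (L.length + (k :: ks ++ R').length)
      simp only [List.length_append, List.length_cons, List.length_nil, add_zero] at *
      rw [show L.length + ks.length + R'.length + 1 =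
        L.length + (ks.length + 1 + R'.length) by omega] at hn
      rw [show L.length + (ks.length + R'.length) + 1 =
        L.length + (ks.length + 1 + R'.length) by omega]
      push_cast
      linarith
    | right hl hF hh hL hC hφ =>
      rename_i h' F L' ks CL' cs k l φl ψ
      subst hL hC hφ
      obtain ⟨n, l', r', φl', φr', hs, hl', hr', hn⟩ := exists_splay F F₂ k hl htn
        (by subst hh; simpa [add_comm] using hF)
      refine ⟨1 + n, _, _, (BSTStep.moveUp t (.right k l) (F ++ F₂)).steps.trans hs,
        .mk (φ₁ := φl' + φr' + lg ((L' ++ ks).length + ([] ++ R).length + 1))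
          (.node hl' hr' (by simp) (by simp) rfl) hG rfl, ?_⟩
      have h₂ := lg_nonneg (ks.length + ([] : List α).length + 1)
      have h₃ : lg h' = lg (ks.length + ([] : List α).length + 1) := by simp [hh]
      have h₄ := lg_nonneg ((L' ++ ks ++ [k]).length + R.length)
      simp only [List.length_append, List.length_cons, List.length_nil, add_zero, zero_add] at *
      rw [show L'.length + ks.length + R.length + 1 =
        L'.length + ks.length + 1 + R.length by omega] at hn ⊢
      push_cast
      linarith

/-- The child is exposed as an empty interval of keys, between its neighbouring keys in the parent.
-/
lemma amortized_moveDown (hw : IsUnitBound B w) {U L R : List α} {CU CL CR : List (BTree α)}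
    {G : List (BTreeFrame α)} (hL : CL.length = L.length) (hLR : L ++ R ≠ [])
    (hLRB : (L ++ R).length + 1 ≤ B) :
    Amortized B (14 * w) ⟨.node (L ++ R) (CL ++ .node U CU :: CR), G⟩
      ⟨.node U CU, ⟨L, CL, R, CR⟩ :: G⟩ := by
  rintro _ φ ⟨ht, hG, hφ⟩
  rename_i t F φ₁ φ₂
  have hR := ht.length_eq
  simp only [List.length_append, List.length_cons] at hR hLRB
  obtain ⟨n, s, F', φ₁', φ₂', hs, hU, -, hF', hn⟩ :=
    exists_expose (B := B) F (L := L) (U := []) (R := R) (CL := CL) (CU := [.node U CU]) (CR := CR)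
      (by simpa using ht) hL rfl (by omega) (by
        intro s φ h
        obtain ⟨hU, -, h⟩ := h.of_node
        obtain ⟨_, _, _, rfl⟩ := h.ne_nil hU
        simp)
  refine ⟨n, _, _, hs, .mk hU.of_node.2.2 (.cons hLR (by simpa using hLRB) hF' hG rfl rfl) rfl, ?_⟩
  have hlg := hw.2 (L.length + ([] : List α).length + R.length) (by simp; omega)
  have h1 := hw.1
  linarith

/-- The binary tree need not change when the border between two regions is erased, but every region
ancestor of the child then has a larger size. The child is therefore first exposed, which leaves at
most two such ancestors. -/
lemma amortized_merge (hw : IsUnitBound B w) {U L R : List α} {CU CL CR : List (BTree α)}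
    {G : List (BTreeFrame α)} (hU : U ≠ []) (hUB : U.length + 1 ≤ B) :
    Amortized B (26 * w) ⟨.node U CU, ⟨L, CL, R, CR⟩ :: G⟩
      ⟨.node (L ++ U ++ R) (CL ++ CU ++ CR), G⟩ := by
  intro σ φ hσ
  have hσ' := hσ
  obtain ⟨-, hP, -⟩ := hσ'
  cases hP with
  | cons hLR hLRB hF =>
    obtain ⟨hL, hR⟩ := hF.length_eq
    obtain ⟨m, _, φ', hm, hσ', hm'⟩ := amortized_moveUp hw hU hUB _ _ hσ
    obtain ⟨ht, hG, hφ⟩ := hσ'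
    rename_i t F φ₁ φ₂
    obtain ⟨n, s, F', φ₁', φ₂', hs, hU', hF2, hF', hn⟩ :=
      exists_expose (B := B) F (L := L) (U := []) (R := R) (CL := CL) (CU := [.node U CU])
        (CR := CR) (by simpa using ht) hL rfl hR (by
          intro s φ h
          obtain ⟨hU, -, h⟩ := h.of_node
          obtain ⟨_, _, _, rfl⟩ := h.ne_nil hU
          simp)
    obtain ⟨ψ, hψ, hle, -⟩ := hF'.exists_change U.length
    refine ⟨m + (n + F'.length), _, _, hm.trans (hs.trans (BSTSteps.up _ _ _)),
      .mk (hψ.plug hU'.of_node.2.2 rfl) hG rfl, ?_⟩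
    have hlg := hw.2 (L.length + ([] : List α).length + R.length) (by simp at hLRB ⊢; omega)
    have hlg' := hw.2 (U.length + L.length + R.length) (by simp at hLRB ⊢; omega)
    have hlg'' := hw.2 ((L ++ R).length + U.length + 1) (by simp at hLRB ⊢; omega)
    have h1 := hw.1
    have h2 : (F'.length : ℝ) ≤ 2 := by exact_mod_cast hF2
    have h3 : F'.length * lg (U.length + L.length + R.length) ≤ 2 * w :=
      mul_le_mul h2 hlg' (lg_nonneg _) (by norm_num)
    have h4 := minPot_add_minPot_le_add (L ++ R).length U.length
    rw [show (L ++ U ++ R).length = (L ++ R).length + U.length by simp; omega]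
    push_cast
    linarith

/-- Once the interval is exposed, its subtree is declared a region of its own. This only lowers the
sizes at its ancestors, so apart from the exposure the cost is one logarithm for `minPot`. -/
lemma amortized_carve (hw : IsUnitBound B w) {U L R : List α} {CU CL CR : List (BTree α)}
    {G : List (BTreeFrame α)} (hL : CL.length = L.length) (hU : CU.length = U.length + 1)
    (hU' : U ≠ []) (hUB : U.length ≤ B) (hLR : L ++ R ≠ []) (hLRB : (L ++ R).length + 1 ≤ B) :
    Amortized B (15 * w) ⟨.node (L ++ U ++ R) (CL ++ CU ++ CR), G⟩
      ⟨.node U CU, ⟨L, CL, R, CR⟩ :: G⟩ := by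
  rintro _ φ ⟨ht, hG, hφ⟩
  rename_i t F φ₁ φ₂
  have hR := ht.length_eq
  simp only [List.length_append] at hR hLRB
  obtain ⟨n, s, F', φ₁', φ₂', hs, hUs, -, hF', hn⟩ :=
    exists_expose F ht hL hU (by omega) (by
        intro s φ h
        obtain ⟨_, _, _, rfl⟩ := h.ne_nil hU'
        simp)
  obtain ⟨ψ, hψ, -, hle⟩ := hF'.exists_change 0
  refine ⟨n, _, _, hs, .mk hUs (.cons hLR (by simpa using hLRB) hψ hG rfl rfl) rfl, ?_⟩
  have hlg := hw.2 (L.length + U.length + R.length) (by omega)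
  have hlg' := hw.2 ((L ++ R).length + U.length + 1) (by simp; omega)
  have h4 := minPot_add_le (L ++ R).length U.length
  rw [show (L ++ U ++ R).length = (L ++ R).length + U.length by simp; omega] at hφ
  have := hle (by omega)
  have h1 := hw.1
  linarith

/-- The current node is replaced by the key `k` and two children. -/
lemma amortized_splitNode (hw : IsUnitBound B w) {U V : List α} {k : α} {CU CV : List (BTree α)}
    {G : List (BTreeFrame α)} (hU : U ≠ []) (hV : V ≠ []) (hCU : CU.length = U.length + 1)
    (hCV : CV.length = V.length + 1) (hB : (U ++ k :: V).length + 1 ≤ B) :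
    Amortized B (44 * w) ⟨.node (U ++ k :: V) (CU ++ CV), G⟩
      ⟨.node [k] [.node U CU, .node V CV], G⟩ := by
  simp only [List.length_append, List.length_cons] at hB
  have h₁ := amortized_carve hw (L := U ++ [k]) (U := V) (R := []) (CL := CU) (CU := CV)
    (CR := []) (G := G) (by simpa using hCU) hCV hV (by omega) (by simp) (by simp; omega)
  have h₂ := amortized_moveUp hw (L := U ++ [k]) (U := V) (R := []) (CL := CU) (CU := CV)
    (CR := []) (G := G) hV (by omega)
  have h₃ := amortized_carve hw (L := []) (U := U) (R := [k]) (CL := []) (CU := CU)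
    (CR := [.node V CV]) (G := G) (by simp) hCU hU (by omega) (by simp) (by simp; omega)
  have h₄ := amortized_moveUp hw (L := []) (U := U) (R := [k]) (CL := []) (CU := CU)
    (CR := [.node V CV]) (G := G) hU (by omega)
  simp only [List.append_assoc, List.cons_append, List.nil_append, List.append_nil]
    at h₁ h₂ h₃ h₄
  exact ((h₁.trans h₂ le_rfl).trans h₃ le_rfl).trans h₄ (by linarith)

/-- The two children of a node with a single key are merged into it. -/
lemma amortized_joinNode (hw : IsUnitBound B w) {U V : List α} {k : α} {CU CV : List (BTree α)}
    {G : List (BTreeFrame α)} (hU : U ≠ []) (hV : V ≠ []) (hCU : CU.length = U.length + 1)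
    (hB : U.length + V.length + 2 ≤ B) :
    Amortized B (80 * w) ⟨.node [k] [.node U CU, .node V CV], G⟩
      ⟨.node (U ++ k :: V) (CU ++ CV), G⟩ := by
  have h₁ := amortized_moveDown hw (L := []) (U := U) (R := [k]) (CL := []) (CU := CU)
    (CR := [.node V CV]) (G := G) rfl (by simp) (by simp; omega)
  have h₂ := amortized_merge hw (L := []) (U := U) (R := [k]) (CL := []) (CU := CU)
    (CR := [.node V CV]) (G := G) hU (by omega)
  have h₃ := amortized_moveDown hw (L := U ++ [k]) (U := V) (R := []) (CL := CU) (CU := CV)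
    (CR := []) (G := G) (by simpa using hCU) (by simp) (by simp; omega)
  have h₄ := amortized_merge hw (L := U ++ [k]) (U := V) (R := []) (CL := CU) (CU := CV)
    (CR := []) (G := G) hV (by omega)
  simp only [List.append_assoc, List.cons_append, List.nil_append, List.append_nil]
    at h₁ h₂ h₃ h₄
  exact ((h₁.trans h₂ le_rfl).trans h₃ le_rfl).trans h₄ (by linarith)

end Simulate

-- From single operations to whole executions.

section Execute

variable {α : Type u} {B : ℕ} {w : ℝ}

lemma Region.exists_represents {t : BinaryTree α} {ks : List α} {cs : List (BTree α)} {φ : ℝ}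
    (h : Region B ks cs t φ) {c : BTree α} (hc : c ∈ cs) : ∃ t φ, Represents B c t φ := by
  induction t generalizing ks cs φ with
  | nil =>
    cases h with
    | leaf h => exact ⟨_, _, List.mem_singleton.1 hc ▸ h⟩
  | node k l r ihl ihr =>
    cases h with
    | leaf h => exact ⟨_, _, List.mem_singleton.1 hc ▸ h⟩
    | node hl hr _ hcs =>
      subst hcs
      exact (List.mem_append.1 hc).elim (ihl hl) (ihr hr)

/-- The join operations do not themselves demand that the sibling has keys; its representation does.
Filling the hole with the null tree makes a region in which the sibling occurs as a child. -/
lemma RegionPath.node_ne_nil {h : ℕ} {F : List (BSTFrame α)} {L R V : List α}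
    {CL CR CV : List (BTree α)} {φ : ℝ} (hF : RegionPath B h F L CL R CR φ)
    (hV : .node V CV ∈ CL ++ CR) : V ≠ [] := by
  obtain ⟨ψ, hψ, -⟩ := hF.exists_change 0
  have hreg := hψ.plug (ks := []) (.leaf .nil) rfl
  obtain ⟨t, φ', ht⟩ := hreg.exists_represents (c := .node V CV) (by
    simp only [List.mem_append] at hV ⊢
    tauto)
  cases ht with
  | node h => exact h

lemma push_of_ne {L R : List α} {CL CR : List (BTree α)} {G : List (BTreeFrame α)}
    (h : L ++ R ≠ []) : BTreeFrame.push ⟨L, CL, R, CR⟩ G = ⟨L, CL, R, CR⟩ :: G := by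
  simp only [BTreeFrame.push, List.isEmpty_iff]
  exact if_neg h

/-- The separating key is carved out together with its two children, which reduces the join to a
node with a single key. If it is the only key of the parent, the deletion of the parent makes
carving superfluous. -/
lemma amortized_join (hw : IsUnitBound B w) {L R U V : List α} {k : α}
    {CL CR CU CV : List (BTree α)} {G : List (BTreeFrame α)} (hL : CL.length = L.length)
    (hR : CR.length = R.length) (hLR : (L ++ k :: R).length + 1 ≤ B) (hU : U ≠ []) (hV : V ≠ [])
    (hCU : CU.length = U.length + 1) (hB : U.length + V.length + 2 ≤ B) :
    Amortized B (95 * w) ⟨.node (L ++ k :: R) (CL ++ .node U CU :: .node V CV :: CR), G⟩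
      ⟨.node (U ++ k :: V) (CU ++ CV), BTreeFrame.push ⟨L, CL, R, CR⟩ G⟩ := by
  have h1 := hw.1
  rcases eq_or_ne (L ++ R) [] with h | h
  · simp only [List.append_eq_nil_iff] at h
    obtain ⟨rfl, rfl⟩ := h
    obtain rfl : CL = [] := by simpa using hL
    obtain rfl : CR = [] := by simpa using hR
    intro σ φ hσ
    obtain ⟨n, σ', φ', hs, hσ', hn⟩ := amortized_joinNode hw hU hV hCU hB σ φ hσ
    exact ⟨n, σ', φ', hs, hσ', by linarith⟩
  · rw [push_of_ne h]
    simp only [List.length_append, List.length_cons] at hLR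
    have h₁ := amortized_carve hw (L := L) (U := [k]) (R := R) (CL := CL)
      (CU := [.node U CU, .node V CV]) (CR := CR) (G := G) hL (by simp) (by simp)
      (by simp; omega) h (by simp; omega)
    simp only [List.append_assoc, List.cons_append, List.nil_append] at h₁
    exact h₁.trans (amortized_joinNode hw hU hV hCU hB) (by linarith)

/-- The state of the B-tree model is valid and represented by a state of the BST model. -/
inductive RepresentsState (B : ℕ) : BTreeState α → BSTState α → ℝ → Prop
  | nil : RepresentsState B ⟨.nil, []⟩ ⟨.nil, []⟩ 0
  | node {ks : List α} {cs : List (BTree α)} {G : List (BTreeFrame α)} {σ : BSTState α} {φ : ℝ} :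
      ks ≠ [] → ks.length + 1 ≤ B → AtNode B ⟨.node ks cs, G⟩ σ φ →
      RepresentsState B ⟨.node ks cs, G⟩ σ φ

lemma Amortized.exists_steps {c d : ℝ} {s : BTreeState α} {ks : List α} {cs : List (BTree α)}
    {G : List (BTreeFrame α)} (h : Amortized B c s ⟨.node ks cs, G⟩) {σ : BSTState α} {φ : ℝ}
    (hσ : AtNode B s σ φ) (hks : ks ≠ []) (hB : ks.length + 1 ≤ B) (hc : c ≤ d) :
    ∃ (n : ℕ) (σ' : BSTState α) (φ' : ℝ), BSTSteps n σ σ' ∧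
      RepresentsState B ⟨.node ks cs, G⟩ σ' φ' ∧ n + φ' ≤ φ + d := by
  obtain ⟨n, σ', φ', hs, hσ', hn⟩ := h σ φ hσ
  exact ⟨n, σ', φ', hs, .node hks hB hσ', by linarith⟩

/-- One operation of the B-tree model is simulated. -/
lemma RepresentsState.exists_steps (hw : IsUnitBound B w) {s s' : BTreeState α} {σ : BSTState α}
    {φ : ℝ} (hσ : RepresentsState B s σ φ) (hs : BTreeStep B s s') :
    ∃ (n : ℕ) (σ' : BSTState α) (φ' : ℝ), BSTSteps n σ σ' ∧ RepresentsState B s' σ' φ' ∧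
      n + φ' ≤ φ + 150 * w := by
  have h1 := hw.1
  cases hs with
  | moveDown L R ks CL CR cs G hL =>
    cases hσ with
    | node hne hB hσ =>
      have hσ' := hσ
      obtain ⟨ht, -, -⟩ := hσ'
      obtain ⟨t, ψ, ht⟩ := ht.exists_represents (c := .node ks cs) (by simp)
      cases ht with
      | node h₁ h₂ =>
        exact (amortized_moveDown hw hL hne hB).exists_steps hσ h₁ h₂ (by linarith)
  | moveUp t f G =>
    cases hσ with
    | node hne hB hσ =>
      have hσ' := hσ
      obtain ⟨-, hP, -⟩ := hσ'
      cases hP with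
      | cons hLR hLRB =>
        exact (amortized_moveUp hw hne hB).exists_steps hσ hLR hLRB (by linarith)
  | rotate L U R L' U' R' CL CU CR CL' CU' CR' G hks hcs hL' hU' hR' hne' hUB' hLRB' =>
    cases hσ with
    | node hne hB hσ =>
      -- A rotation forgets the old interval by merging and then carves out the new one; if the new
      -- interval is everything, the merge alone suffices.
      have h := amortized_merge hw (L := L) (R := R) (CL := CL) (CR := CR) (CU := CU) (G := G)
        hne hB
      rw [← hks, ← hcs] at h
      rcases eq_or_ne (L' ++ R') [] with h' | h'
      · simp only [List.append_eq_nil_iff] at h'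
        obtain ⟨rfl, rfl⟩ := h'
        obtain rfl : CL' = [] := by simpa using hL'
        obtain rfl : CR' = [] := by simpa using hR'
        simp only [List.nil_append, List.append_nil] at h
        exact h.exists_steps hσ hne' hUB' (by linarith)
      · rw [push_of_ne h']
        exact (h.trans (amortized_carve hw hL' hU' hne' (by omega) h' hLRB') le_rfl).exists_steps
          hσ hne' hUB' (by linarith)
  | splitL L R U V k CL CR CU CV G hU hV hCU hCV hLR =>
    cases hσ with
    | node hne hB hσ =>
      have hσ' := hσ
      obtain ⟨-, hP, -⟩ := hσ'
      cases hP with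
      | cons _ _ hF =>
        obtain ⟨hL, hR⟩ := hF.length_eq
        -- The node is split as if it were the root, the resulting node with the single key `k` is
        -- merged into the parent, and the pointer moves down to the required half.
        have h₁ := (amortized_splitNode hw (G := ⟨L, CL, R, CR⟩ :: G) hU hV hCU hCV hB).trans
          (amortized_merge hw (by simp) (by simp; omega)) le_rfl
        have h₂ := amortized_moveDown hw (L := L) (U := U) (R := k :: R) (CL := CL) (CU := CU)
          (CR := .node V CV :: CR) (G := G) hL (by simp) (by simp at hLR ⊢; omega)
        simp only [List.append_assoc, List.cons_append, List.nil_append] at h₁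
        exact (h₁.trans h₂ le_rfl).exists_steps hσ hU (by simp at hB; omega) (by linarith)
  | splitR L R U V k CL CR CU CV G hU hV hCU hCV hLR =>
    cases hσ with
    | node hne hB hσ =>
      have hσ' := hσ
      obtain ⟨-, hP, -⟩ := hσ'
      cases hP with
      | cons _ _ hF =>
        obtain ⟨hL, hR⟩ := hF.length_eq
        have h₁ := (amortized_splitNode hw (G := ⟨L, CL, R, CR⟩ :: G) hU hV hCU hCV hB).trans
          (amortized_merge hw (by simp) (by simp; omega)) le_rfl
        have h₂ := amortized_moveDown hw (L := L ++ [k]) (U := V) (R := R)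
          (CL := CL ++ [.node U CU]) (CU := CV) (CR := CR) (G := G) (by simpa using hL) (by simp)
          (by simp at hLR ⊢; omega)
        simp only [List.append_assoc, List.cons_append, List.nil_append] at h₁ h₂
        exact (h₁.trans h₂ le_rfl).exists_steps hσ hV (by simp at hB; omega) (by linarith)
  | splitRootL U V k CU CV hU hV hCU hCV =>
    cases hσ with
    | node hne hB hσ =>
      have h := (amortized_splitNode hw (G := []) hU hV hCU hCV hB).trans
        (amortized_moveDown hw (L := []) (U := U) (R := [k]) (CL := []) (CU := CU)
          (CR := [.node V CV]) rfl (by simp) (by simp at hB ⊢; omega)) le_rfl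
      exact h.exists_steps hσ hU (by simp at hB; omega) (by linarith)
  | splitRootR U V k CU CV hU hV hCU hCV =>
    cases hσ with
    | node hne hB hσ =>
      have h := (amortized_splitNode hw (G := []) hU hV hCU hCV hB).trans
        (amortized_moveDown hw (L := [k]) (U := V) (R := []) (CL := [.node U CU]) (CU := CV)
          (CR := []) rfl (by simp) (by simp at hB ⊢; omega)) le_rfl
      exact h.exists_steps hσ hV (by simp at hB; omega) (by linarith)
  | joinRight L R U V k CL CR CU CV G hUV =>
    cases hσ with
    | node hU hB hσ =>
      have hσ' := hσ
      obtain ⟨ht, hP, -⟩ := hσ'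
      cases hP with
      | cons _ hLRB hF =>
        obtain ⟨hL, hR⟩ := hF.length_eq
        have hV : V ≠ [] := hF.node_ne_nil (CV := CV) (by simp)
        exact ((amortized_moveUp hw hU hB).trans (amortized_join hw hL (by simpa using hR) hLRB hU
          hV ht.length_eq hUV) le_rfl).exists_steps hσ (by simp) (by simp; omega) (by linarith)
  | joinLeft L R U V k CL CR CU CV G hUV =>
    cases hσ with
    | node hV hB hσ =>
      have hσ' := hσ
      obtain ⟨ht, hP, -⟩ := hσ'
      cases hP with
      | cons _ hLRB hF =>
        obtain ⟨hL, hR⟩ := hF.length_eq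
        have hmem : BTree.node U CU ∈ CL ++ [.node U CU] ++ CR := by simp
        have hU : U ≠ [] := hF.node_ne_nil hmem
        obtain ⟨ψ, hψ, -⟩ := hF.exists_change 0
        obtain ⟨t, _, hrep⟩ := (hψ.plug (ks := []) (.leaf .nil) rfl).exists_represents
          (c := .node U CU) (by simp)
        have hCU : CU.length = U.length + 1 := by
          cases hrep with
          | node _ _ h => exact h.length_eq
        have h := amortized_moveUp hw (CU := CV) (L := L ++ [k]) (R := R)
          (CL := CL ++ [.node U CU]) (CR := CR) (G := G) hV hB
        simp only [List.append_assoc, List.cons_append, List.nil_append] at h hLRB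
        exact (h.trans (amortized_join hw (by simpa using hL) hR hLRB hU hV hCU hUV)
          le_rfl).exists_steps hσ (by simp) (by simp; omega) (by linarith)

lemma RepresentsState.exists_steps_of_steps (hw : IsUnitBound B w)
    {s s' : (btreeModel α B).State}
    {σ : BSTState α} {φ : ℝ} {m : ℕ} (hσ : RepresentsState B s σ φ)
    (hs : (btreeModel α B).Steps m s s') :
    ∃ (n : ℕ) (σ' : BSTState α) (φ' : ℝ), BSTSteps n σ σ' ∧ RepresentsState B s' σ' φ' ∧
      n + φ' ≤ φ + 150 * w * m := by
  induction hs with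
  | refl => exact ⟨0, σ, φ, .refl _, hσ, by simp⟩
  | tail _ hstep ih =>
    obtain ⟨n, σ', φ', h, hσ', hn⟩ := ih hσ
    obtain ⟨n', σ'', φ'', h', hσ'', hn'⟩ := hσ'.exists_steps hw hstep
    refine ⟨n + n', σ'', φ'', h.trans h', hσ'', ?_⟩
    push_cast
    linarith

/-- A key of the current node is touched. -/
lemma RepresentsState.exists_touch (hw : IsUnitBound B w) {s : BTreeState α} {σ : BSTState α}
    {φ : ℝ} (hσ : RepresentsState B s σ φ) {x : α} (hx : s.Touches x) :
    ∃ (n : ℕ) (σ' : BSTState α) (φ' : ℝ), BSTSteps n σ σ' ∧ RepresentsState B s σ' φ' ∧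
      σ'.Touches x ∧ n + φ' ≤ φ + 6 * w := by
  obtain ⟨ks', cs', hfoc, hx⟩ := hx
  cases hσ with
  | nil => cases hfoc
  | node hne hB hσ =>
    cases hfoc
    obtain ⟨ht, hG, hφ⟩ := hσ
    rename_i G t F φ₁ φ₂
    obtain ⟨A, D, rfl⟩ := List.append_of_mem hx
    obtain ⟨n, l, r, C₁, C₂, φl, φr, hs, hl, hr, hC, hn⟩ := exists_access F ht
    refine ⟨n, _, _, hs, .node hne hB (.mk (.node hl hr rfl hC.symm rfl) hG rfl), ⟨l, r, rfl⟩, ?_⟩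
    have hlg := hw.2 (A.length + D.length + 1) (by simp at hB; omega)
    have h1 := hw.1
    linarith

/-- Between searches only the trees survive. Refilling the holes region by region leaves the total
potential unchanged, so it carries over to the next search. -/
lemma RepresentsPath.represents_tree {G : List (BTreeFrame α)} {F : List (BSTFrame α)} {ψ : ℝ}
    (hG : RepresentsPath B G F ψ) {b : BTree α} {t : BinaryTree α} {φ : ℝ}
    (ht : Represents B b t φ) :
    Represents B (G.foldl (fun t f => f.fill t) b) (F.foldl (fun t f => f.fill t) t) (φ + ψ) := by
  induction hG generalizing b t φ with
  | nil => simpa using ht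
  | cons hLR hLRB hF hG hF'' hφ ih =>
    subst hF'' hφ
    rw [List.foldl_append, List.foldl_cons]
    have h := hF.plug (ks := []) (.leaf ht) rfl
    simp only [List.append_nil, List.append_assoc, List.cons_append, List.nil_append] at h
    have h' := ih (.node hLR hLRB h rfl)
    rw [show ∀ a b c d : ℝ, a + (b - c + d) = a + b - c + d by intros; ring]
    exact h'

lemma RepresentsState.represents_tree {s : BTreeState α} {σ : BSTState α} {φ : ℝ}
    (hσ : RepresentsState B s σ φ) : Represents B s.tree σ.tree φ := by
  cases hσ with
  | nil => exact .nil
  | node hne hB hσ =>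
    obtain ⟨ht, hG, rfl⟩ := hσ
    exact hG.represents_tree (.node hne hB ht rfl)

lemma Represents.start {b : BTree α} {t : BinaryTree α} {φ : ℝ} (h : Represents B b t φ) :
    RepresentsState B ⟨b, []⟩ ⟨t, []⟩ φ := by
  cases h with
  | nil => exact .nil
  | node hne hB ht hφ => exact .node hne hB (.mk ht .nil (by rw [hφ, add_zero]))

/-- Executions of the B-tree model are simulated by the BST model. -/
lemma exists_serves (hw : IsUnitBound B w) {b : (btreeModel α B).Tree} {X : List α} {c : ℕ}
    (h : (btreeModel α B).Serves b X c) {t : BinaryTree α} {φ : ℝ} (ht : Represents B b t φ) :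
    ∃ d : ℕ, (bstModel α).Serves t X d ∧ d ≤ φ + 150 * w * c := by
  induction h generalizing t φ with
  -- The potential left at the end is discarded, which is where its nonnegativity enters.
  | nil => exact ⟨0, .nil (M := bstModel α) t, by simpa using ht.nonneg⟩
  | cons hsearch _ ih =>
    obtain ⟨m, n, s, s', hs, hx, hs', rfl, rfl⟩ := hsearch
    obtain ⟨m₁, σ₁, φ₁, h₁, hσ₁, hm₁⟩ := ht.start.exists_steps_of_steps hw hs
    obtain ⟨m₂, σ₂, φ₂, h₂, hσ₂, hx₂, hm₂⟩ := hσ₁.exists_touch hw hx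
    obtain ⟨m₃, σ₃, φ₃, h₃, hσ₃, hm₃⟩ := hσ₂.exists_steps_of_steps hw hs'
    obtain ⟨d, hd, hdle⟩ := ih hσ₃.represents_tree
    refine ⟨1 + (m₁ + m₂) + m₃ + d, .cons ⟨m₁ + m₂, m₃, σ₂, σ₃, h₁.trans h₂, hx₂, h₃, rfl, rfl⟩ hd,
      ?_⟩
    -- The unit cost of placing the B-tree pointer gives a budget of `150 * w`, which covers placing
    -- the binary pointer and the touch at `6 * w`.
    have h1 := hw.1
    push_cast
    linarith

end Execute

-- Constants and optimal costs.

lemma isUnitBound {B : ℕ} (hB : 2 ≤ B) : IsUnitBound B (15 * Real.log B) := by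
  have hB' : (2 : ℝ) ≤ B := by exact_mod_cast hB
  refine ⟨?_, fun n hn => ?_⟩
  · have h := Real.log_le_log (by norm_num) hB'
    have := Real.log_two_gt_d9
    linarith
  -- For `B ≥ 2`, `2 * B + 1 ≤ B ^ 3`; the exponent 3 and the factor 5 of `lg` give 15, whence the
  -- final constant `2250 = 150 * 15`.
  · have h := lg_mono (show n ≤ B ^ 3 by nlinarith [pow_two B, pow_succ B 2])
    refine h.trans_eq ?_
    rw [lg, Nat.cast_pow, Real.log_pow]
    push_cast
    ring

/-- A finite infimum in `ℕ∞` is attained, as it is smaller than itself plus one. -/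
lemma PointerModel.exists_serves_of_optFrom {α : Type u} {M : PointerModel α} {t : M.Tree}
    {X : List α} (h : M.optFrom t X ≠ ⊤) : ∃ c : ℕ, M.Serves t X c ∧ (c : ℕ∞) ≤ M.optFrom t X := by
  have h' : M.optFrom t X < M.optFrom t X + 1 := ENat.lt_add_one_iff h |>.2 le_rfl
  nth_rewrite 1 [PointerModel.optFrom] at h'
  simp only [iInf_lt_iff] at h'
  obtain ⟨c, hc, hlt⟩ := h'
  exact ⟨c, hc, (ENat.lt_add_one_iff h).1 hlt⟩

lemma PointerModel.optFrom_le {α : Type u} {M : PointerModel α} {t : M.Tree}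
    {X : List α} {c : ℕ} (h : M.Serves t X c) : M.optFrom t X ≤ c :=
  iInf₂_le c h

lemma exists_isBTree_of_btreeOpt {α : Type u} [LT α] {B : ℕ} {X : List α} (h : btreeOpt B X ≠ ⊤) :
    ∃ t : BTree α, t.IsBTree B ∧ (btreeModel α B).optFrom t X ≤ btreeOpt B X := by
  have h' : btreeOpt B X < btreeOpt B X + 1 := ENat.lt_add_one_iff h |>.2 le_rfl
  nth_rewrite 1 [btreeOpt] at h'
  simp only [iInf_lt_iff] at h'
  obtain ⟨t, ht, hlt⟩ := h'
  exact ⟨t, ht, (ENat.lt_add_one_iff h).1 hlt⟩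

/-- The optimal costs for initial trees of which one represents the other. -/
lemma optFrom_le_of_represents {α : Type u} {B : ℕ} (hB : 2 ≤ B) {b : BTree α} {t : BinaryTree α}
    (ht : Represents B b t 0) (X : List α) :
    (((bstModel α).optFrom t X : ℕ∞) : ENNReal) ≤
      ENNReal.ofReal (2250 * Real.log B) * (((btreeModel α B).optFrom b X : ℕ∞) : ENNReal) := by
  have hw := isUnitBound hB
  have hpos : 0 < 2250 * Real.log B := by linarith [hw.1]
  by_cases htop : (btreeModel α B).optFrom b X = ⊤
  -- Positivity of the factor matters, as `0 * ⊤ = 0` in `ENNReal`.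
  · rw [htop, ENat.toENNReal_top, ENNReal.mul_top (by simpa using hpos)]
    exact le_top
  obtain ⟨c, hc, hle⟩ := PointerModel.exists_serves_of_optFrom htop
  obtain ⟨d, hd, hdle⟩ := exists_serves hw hc ht
  calc (((bstModel α).optFrom t X : ℕ∞) : ENNReal) ≤ ((d : ℕ∞) : ENNReal) :=
        ENat.toENNReal_le.2 (PointerModel.optFrom_le hd)
    _ = ENNReal.ofReal d := by rw [ENat.toENNReal_coe, ENNReal.ofReal_natCast]
    _ ≤ ENNReal.ofReal (2250 * Real.log B * c) := ENNReal.ofReal_le_ofReal (by linarith)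
    _ = ENNReal.ofReal (2250 * Real.log B) * ((c : ℕ∞) : ENNReal) := by
        rw [ENNReal.ofReal_mul hpos.le, ENat.toENNReal_coe, ENNReal.ofReal_natCast]
    _ ≤ _ := mul_le_mul_right (ENat.toENNReal_le.2 hle) _

/-- There is an absolute constant `C` such that, for all numbers `N` of keys, all `B ≥ 2` and all
search sequences `X`, the optimal BST cost of `X` is at most `C * log B` times its optimal B-tree
cost: both when the initial trees are free to choose, and when a common initial binary search tree
is prescribed. -/
theorem theorem1 :
    ∃ C : ℝ, 0 < C ∧ ∀ (N B : ℕ) (X : List (Fin N)), 2 ≤ B →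
      ((bstOpt X : ℕ∞) : ENNReal) ≤
          ENNReal.ofReal (C * Real.log B) * ((btreeOpt B X : ℕ∞) : ENNReal) ∧
      ∀ T₀ : BinaryTree (Fin N), T₀.IsBST →
        (((bstModel (Fin N)).optFrom T₀ X : ℕ∞) : ENNReal) ≤
          ENNReal.ofReal (C * Real.log B) *
            (((btreeModel (Fin N) B).optFrom T₀.toBTree X : ℕ∞) : ENNReal) := by
  refine ⟨2250, by norm_num, fun N B X hB =>
    ⟨?_, fun T₀ _ => optFrom_le_of_represents hB (represents_toBTree hB T₀) X⟩⟩
  have hpos : 0 < 2250 * Real.log B := by linarith [(isUnitBound hB).1]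
  by_cases htop : btreeOpt B X = ⊤
  · rw [htop, ENat.toENNReal_top, ENNReal.mul_top (by simpa using hpos)]
    exact le_top
  obtain ⟨b, ⟨hb, hkeys⟩, hle⟩ := exists_isBTree_of_btreeOpt htop
  obtain ⟨t, ht⟩ := hb.exists_represents
  have htBST : t.IsBST := by
    rw [BinaryTree.IsBST, ← ht.keysInorder_eq]
    exact hkeys
  calc ((bstOpt X : ℕ∞) : ENNReal) ≤ (((bstModel (Fin N)).optFrom t X : ℕ∞) : ENNReal) :=
        ENat.toENNReal_le.2 (iInf₂_le t htBST)
    _ ≤ _ := optFrom_le_of_represents hB ht X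
    _ ≤ _ := mul_le_mul_right (ENat.toENNReal_le.2 hle) _
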